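/- Let $N>3$ be an integer and write $x=(x',x_N)\in\mathbb R^{N}=\mathbb R^{N-1}\times\mathbb R$. For $l,h>0$ let $C(l,h)=\{x'\in\mathbb R^{N-1}:|x'|<l\}\times(-h,h)$. For $h>0$ and a bounded set $K'\subset\mathbb R^{N-1}$ let $$\operatorname{Cap}_h(K',\mathbb R^{N-1})=\inf\Big\{\int_{\mathbb R^{N-1}\times(-h,h)}|\nabla w|^2\,dx\Big\},$$ where the infimum is over all functions $w\in C^\infty(\mathbb R^{N-1}\times[-h,h])$ (smooth up to the boundary) with compact support in $\mathbb R^{N-1}\times[-h,h]$ (not required to vanish on the boundary of the strip) such that $K'\times\{0\}\subset\operatorname{int}(\{w=1\})$. For an open set $U\subset\mathbb R^N$, a bounded set $A\subset\mathbb R^N$ and $a\in\mathbb R$, a function $v\in H^1_{\mathrm{loc}}(U)$ is said to be equal to $a$ weakly on $A$ if there are an open set $W\supset\overline A$ and functions $u_n\in C^\infty(U\cap W)$ such that $\|u_n-(v-a)\|_{H^1(U\cap W)}\to0$ and $A\cap\overline{\operatorname{supp}(u_n)}=\emptyset$ for all $n$, where the closure is taken in $\mathbb R^N$. Let $K'\subset\mathbb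 R^{N-1}$ be bounded and let $\theta\in(0,1)$. Then there exist positive constants $L$, $\tau$ and $c$ (depending only on $N$, $K'$ and $\theta$) such that the following holds. If $l\ge L$, $h>0$, $h/l^{N-1}\le\tau$, and $v\in H^1(C(l,h))$ satisfies $$v=1\ \text{ weakly on } K'\times\{0\},\qquad \int_{C(l,h)}|\nabla v|^2\,dx<\theta\,\operatorname{Cap}_h(K',\mathbb R^{N-1}),$$ then $$\frac1{|C(l,h)|}\int_{C(l,h)}v\,dx>c.$$ -/

import Mathlib

open MeasureTheory Set Filter Topology
open scoped ENNReal ContDiff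

noncomputable section

/-- `ℝ^N = ℝ^(N-1) × ℝ` with the Euclidean norm; a point is written `x = (x', x_N)`, with
`x' = x.fst` and `x_N = x.snd`. -/
abbrev SplitSpace (N : ℕ) : Type := WithLp 2 (EuclideanSpace ℝ (Fin (N - 1)) × ℝ)

/-- The open cylinder `C(l, h) = B'(0, l) × (-h, h)`. -/
def openCylinder (N : ℕ) (l h : ℝ) : Set (SplitSpace N) :=
  {x | x.fst ∈ Metric.ball 0 l ∧ x.snd ∈ Ioo (-h) h}

/-- The open strip `ℝ^(N-1) × (-h, h)`. -/
def strip (N : ℕ) (h : ℝ) : Set (SplitSpace N) :=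
  {x | x.snd ∈ Ioo (-h) h}

/-- The set `K' × {0}`. -/
def flatSet {N : ℕ} (K' : Set (EuclideanSpace ℝ (Fin (N - 1)))) : Set (SplitSpace N) :=
  {x | x.fst ∈ K' ∧ x.snd = 0}

/-- The space `C_h^∞(ℝ^(N-1))`: functions smooth on the closed strip (up to the boundary) whose
support in the closed strip is compact. They need not vanish on the boundary of the strip. Only
the values on the closed strip matter. -/
def IsStripTestFunction (N : ℕ) (h : ℝ) (v : SplitSpace N → ℝ) : Prop :=
  ContDiffOn ℝ ∞ v (closure (strip N h)) ∧
    IsCompact (closure {x | x ∈ closure (strip N h) ∧ v x ≠ 0})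

/-- The capacity `Cap_h(K', ℝ^(N-1))`: the infimum of `∫ |∇v|²` over the strip, among all
`v ∈ C_h^∞(ℝ^(N-1))` with `K' × {0}` contained in the interior of `{v = 1}`. -/
def stripCap {N : ℕ} (h : ℝ) (K' : Set (EuclideanSpace ℝ (Fin (N - 1)))) : ℝ≥0∞ :=
  ⨅ (v : SplitSpace N → ℝ) (_ : IsStripTestFunction N h v)
    (_ : flatSet K' ⊆ interior {x | x ∈ closure (strip N h) ∧ v x = 1}),
    ∫⁻ x in strip N h, ‖gradient v x‖ₑ ^ 2

section Sobolev

variable {E : Type*} [NormedAddCommGroup E] [InnerProductSpace ℝ E] [FiniteDimensional ℝ E]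
  [MeasurableSpace E] [BorelSpace E]

/-- `g` is the weak (distributional) gradient of `v` on the open set `U`. -/
structure HasWeakGradientOn (U : Set E) (v : E → ℝ) (g : E → E) : Prop where
  locallyIntegrableOn : LocallyIntegrableOn v U
  locallyIntegrableOn_grad : LocallyIntegrableOn g U
  integral_eq : ∀ φ : E → ℝ, ContDiff ℝ ∞ φ → HasCompactSupport φ → tsupport φ ⊆ U →
    ∫ x in U, v x • gradient φ x = -∫ x in U, φ x • g x

/-- `v ∈ H¹(U)`, with weak gradient `g`. -/
structure IsH1With (U : Set E) (v : E → ℝ) (g : E → E) : Prop where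
  hasWeakGradientOn : HasWeakGradientOn U v g
  memLp : MemLp v 2 (volume.restrict U)
  memLp_grad : MemLp g 2 (volume.restrict U)

/-- `v ∈ H¹_loc(U)`, with weak gradient `g`. -/
structure IsH1LocWith (U : Set E) (v : E → ℝ) (g : E → E) : Prop where
  hasWeakGradientOn : HasWeakGradientOn U v g
  memLp : ∀ S : Set E, IsCompact S → S ⊆ U → MemLp v 2 (volume.restrict S)
  memLp_grad : ∀ S : Set E, IsCompact S → S ⊆ U → MemLp g 2 (volume.restrict S)

/-- `v ∈ H¹_loc(U)` vanishes weakly on `A`: there are an open neighbourhood `W` of the closure of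
`A` and `u n ∈ C^∞(U ∩ W)` such that `u n → v` in `H¹(U ∩ W)` and such that the closure, in the
whole space, of the support of `u n` does not meet `A`. -/
def VanishesWeaklyOn (U A : Set E) (v : E → ℝ) : Prop :=
  ∃ g : E → E, IsH1LocWith U v g ∧
    ∃ W : Set E, IsOpen W ∧ closure A ⊆ W ∧
      ∃ u : ℕ → E → ℝ,
        (∀ n, ContDiffOn ℝ ∞ (u n) (U ∩ W)) ∧
        (∀ n, Disjoint A (closure {x | x ∈ U ∩ W ∧ u n x ≠ 0})) ∧
        Tendsto (fun n => eLpNorm (fun x => u n x - v x) 2 (volume.restrict (U ∩ W)))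
          atTop (𝓝 0) ∧
        Tendsto (fun n => eLpNorm (fun x => gradient (u n) x - g x) 2 (volume.restrict (U ∩ W)))
          atTop (𝓝 0)

/-- `v = a` weakly on `A`. -/
def EqWeaklyOn (U A : Set E) (v : E → ℝ) (a : ℝ) : Prop :=
  VanishesWeaklyOn U A (fun x => v x - a)

end Sobolev

end

/-! ### Cauchy–Schwarz and Jensen bounds in extended nonnegative form -/

section Inequalities

variable {α : Type*} [MeasurableSpace α] {μ : Measure α}

/-! Let `m` be the mean of `v` over the cylinder. Everything follows from the inequality `(1 - m)²
Cap_h(K') ≤ (1 + δ) ∫ |∇v|²`, valid for `l` large and `h / l^(N-1)` small, where `δ > 0` is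
arbitrary: a function of energy below `θ Cap_h(K')` cannot have mean near `0`, because then the left
side would be nearly `Cap_h(K')`.

For smooth `V` equal to `1` near `K' × {0}`, the competitor for the capacity is `η (V - m) / (1 -
m)`, with `η` a compactly supported cutoff equal to `1` around `K' × {0}`. No condition is imposed
on the top and bottom of the strip, so no energy is lost there. The only error is `∫ |V - m|²
|∇η|²`. A logarithmic cutoff has `|∇η|² ≤ ε / (1 + |x|²)` with `ε` as small as desired, so a Hardy
inequality should absorb the error (`exists_log_cutoff`, `lintegral_sub_average_mul_cutoff_le`).

Hardy is applied on horizontal slices, of dimension `N - 1 ≥ 3`, with a constant independent of `l`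
and `h`: the deviation of `V` from its slice mean is cut off at scale `l`, and Poincaré's inequality
on the ball pays for that cutoff (`exists_lintegral_sub_average_sq_mul_le`). Slice means in turn
differ from `m`, in square, by at most a multiple of `(h / l^(N-1)) ∫ |∇V|²`
(`enorm_slice_average_sub_average_sq_le`). As `η` is supported in a fixed ball of `ℝ^N`, this
contributes little once `h / l^(N-1)` is bounded.

For `v` in `H¹`, the smooth case is used on the smaller cylinder `C(a l, a h)`, `a < 1`, where
mollifications of `v`, glued near `K' × {0}` to the functions given by the weak boundary condition,
converge to `v` (`IsH1With.exists_contDiff_approx`). Vertical scaling gives `Cap_h ≤ a⁻¹ Cap_{ah}`,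
and `a → 1` finishes. -/

theorem ENNReal.add_sq_le_two_mul (a b : ℝ≥0∞) : (a + b) ^ 2 ≤ 2 * a ^ 2 + 2 * b ^ 2 := by
  have := ENNReal.rpow_add_le_mul_rpow_add_rpow a b (one_le_two : (1 : ℝ) ≤ 2)
  norm_num at this
  rwa [mul_add] at this

theorem sq_lintegral_mul_le {f g : α → ℝ≥0∞} (hf : AEMeasurable f μ) (hg : AEMeasurable g μ) :
    (∫⁻ x, f x * g x ∂μ) ^ 2 ≤ (∫⁻ x, f x ^ 2 ∂μ) * ∫⁻ x, g x ^ 2 ∂μ := by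
  have h := ENNReal.lintegral_mul_le_Lp_mul_Lq μ Real.HolderConjugate.two_two hf hg
  simp only [Pi.mul_apply, ENNReal.rpow_ofNat] at h
  refine (pow_le_pow_left' h 2).trans_eq ?_
  rw [mul_pow, ← ENNReal.rpow_natCast, ← ENNReal.rpow_natCast, ← ENNReal.rpow_mul,
    ← ENNReal.rpow_mul]
  norm_num

theorem sq_lintegral_le {f : α → ℝ≥0∞} (hf : AEMeasurable f μ) :
    (∫⁻ x, f x ∂μ) ^ 2 ≤ μ univ * ∫⁻ x, f x ^ 2 ∂μ := by
  simpa using sq_lintegral_mul_le (f := fun _ => 1) aemeasurable_const hf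

theorem enorm_average_sq_le [IsFiniteMeasure μ] {f : α → ℝ} (hf : AEStronglyMeasurable f μ) :
    ‖⨍ x, f x ∂μ‖ₑ ^ 2 ≤ (μ univ)⁻¹ * ∫⁻ x, ‖f x‖ₑ ^ 2 ∂μ := by
  rcases eq_or_ne (μ univ) 0 with h0 | h0
  · have : μ = 0 := by simpa using h0
    simp [this]
  have hle : ‖⨍ x, f x ∂μ‖ₑ ≤ (μ univ)⁻¹ * ∫⁻ x, ‖f x‖ₑ ∂μ := by
    rw [average]
    refine (enorm_integral_le_lintegral_enorm _).trans ?_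
    rw [lintegral_smul_measure, smul_eq_mul]
  refine (pow_le_pow_left' hle 2).trans ?_
  rw [mul_pow, sq (μ univ)⁻¹, mul_assoc]
  gcongr
  refine (mul_le_mul_right (sq_lintegral_le hf.enorm) _).trans_eq ?_
  rw [← mul_assoc, ENNReal.inv_mul_cancel h0 (measure_ne_top _ _), one_mul]

theorem enorm_sub_average_sq_le [IsFiniteMeasure μ] [NeZero μ] {f : α → ℝ} (hf : Integrable f μ)
    (a : ℝ) :
    ‖a - ⨍ x, f x ∂μ‖ₑ ^ 2 ≤ (μ univ)⁻¹ * ∫⁻ x, ‖a - f x‖ₑ ^ 2 ∂μ := by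
  have : a - ⨍ x, f x ∂μ = ⨍ x, (a - f x) ∂μ := by
    have h1 : ⨍ _, a ∂μ = a := by simp
    conv_lhs => rw [← h1]
    rw [average_eq, average_eq, average_eq, ← smul_sub, integral_sub (integrable_const _) hf]
  rw [this]
  exact enorm_average_sq_le (aestronglyMeasurable_const.sub hf.1)

end Inequalities

/-! ### Differences along segments and Poincaré's inequality on balls -/

section OneDim

/-- Fundamental theorem of calculus and Cauchy–Schwarz. The set `I` need only contain the interval,
so that one right-hand side serves all pairs of endpoints. -/
theorem enorm_sub_sq_le_lintegral_deriv {γ : ℝ → ℝ} (hγ : ContDiff ℝ 1 γ) {a b : ℝ}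
    {I : Set ℝ} (hI : uIoc a b ⊆ I) :
    ‖γ b - γ a‖ₑ ^ 2 ≤ volume I * ∫⁻ t in I, ‖deriv γ t‖ₑ ^ 2 := by
  have hc : Continuous (deriv γ) := hγ.continuous_deriv le_rfl
  have h1 : ∫ t in a..b, deriv γ t = γ b - γ a :=
    intervalIntegral.integral_deriv_eq_sub
      (fun x _ => (hγ.differentiable one_ne_zero).differentiableAt)
      (hc.intervalIntegrable _ _)
  have h2 : ‖γ b - γ a‖ₑ ≤ ∫⁻ t in I, ‖deriv γ t‖ₑ := by
    rw [← h1, ← ofReal_norm, intervalIntegral.norm_integral_eq_norm_integral_uIoc, ofReal_norm]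
    exact (enorm_integral_le_lintegral_enorm _).trans (lintegral_mono_set hI)
  refine (pow_le_pow_left' h2 2).trans ?_
  refine (sq_lintegral_le hc.measurable.enorm.aemeasurable).trans ?_
  simp

end OneDim

section Poincare

variable {E : Type*} [NormedAddCommGroup E] [NormedSpace ℝ E]

theorem enorm_sub_sq_le_lintegral_segment {u : E → ℝ} (hu : ContDiff ℝ 1 u) (x y : E) :
    ‖u x - u y‖ₑ ^ 2 ≤
      ‖x - y‖ₑ ^ 2 * ∫⁻ t in Ioc (0 : ℝ) 1, ‖fderiv ℝ u ((1 - t) • x + t • y)‖ₑ ^ 2 := by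
  set γ : ℝ → ℝ := fun t => u ((1 - t) • x + t • y) with hγdef
  have hline : ∀ t : ℝ, HasDerivAt (fun t : ℝ => (1 - t) • x + t • y) (y - x) t := fun t => by
    have h1 := ((hasDerivAt_const t (1 : ℝ)).sub (hasDerivAt_id t)).smul_const x
    have h2 := (hasDerivAt_id t).smul_const y
    convert! h1.add h2 using 1
    simp [sub_eq_neg_add]
  have hγ : ContDiff ℝ 1 γ := hu.comp (by fun_prop)
  have hd : ∀ t, deriv γ t = fderiv ℝ u ((1 - t) • x + t • y) (y - x) := fun t =>
    ((hu.differentiable one_ne_zero _).hasFDerivAt.comp_hasDerivAt t (hline t)).deriv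
  have h := enorm_sub_sq_le_lintegral_deriv hγ (a := 0) (b := 1) (I := Ioc 0 1)
    (by rw [uIoc_of_le zero_le_one])
  simp only [Real.volume_Ioc, sub_zero, ENNReal.ofReal_one, one_mul] at h
  have h01 : γ 1 - γ 0 = u y - u x := by simp [hγdef]
  rw [h01, ← enorm_neg, neg_sub] at h
  refine h.trans ?_
  rw [← lintegral_const_mul' _ _ (by finiteness)]
  refine lintegral_mono fun t => ?_
  rw [hd, ← mul_pow, mul_comm]
  gcongr
  rw [← enorm_neg (x - y), neg_sub]
  exact ContinuousLinearMap.le_opENorm _ _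

variable [FiniteDimensional ℝ E] [MeasurableSpace E] [BorelSpace E] (μ : Measure E)
  [μ.IsAddHaarMeasure]

theorem lintegral_comp_smul_left (f : E → ℝ≥0∞) {r : ℝ} (hr : r ≠ 0) :
    ∫⁻ x, f (r • x) ∂μ = ENNReal.ofReal |(r ^ Module.finrank ℝ E)⁻¹| * ∫⁻ x, f x ∂μ := by
  rw [← smul_eq_mul, ← lintegral_smul_measure, ← Measure.map_addHaar_smul μ hr]
  exact (((Homeomorph.smulOfNeZero r hr).measurableEmbedding).lintegral_map f).symm

theorem lintegral_comp_add_smul_le {f : E → ℝ≥0∞} (a : E) {r : ℝ} (hr : 1 / 2 ≤ r) :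
    ∫⁻ x, f (a + r • x) ∂μ ≤ 2 ^ Module.finrank ℝ E * ∫⁻ x, f x ∂μ := by
  have hr0 : 0 < r := by linarith
  rw [lintegral_comp_smul_left μ (fun x => f (a + x)) hr0.ne', lintegral_add_left_eq_self f a]
  gcongr
  have h2 : |(r ^ Module.finrank ℝ E)⁻¹| ≤ 2 ^ Module.finrank ℝ E := by
    rw [abs_of_pos (by positivity), ← inv_pow]
    gcongr
    rw [inv_le_comm₀ hr0 two_pos]
    linarith
  exact (ENNReal.ofReal_le_ofReal h2).trans_eq (by rw [ENNReal.ofReal_pow two_pos.le]; simp)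

/-- One of `t` and `1 - t` is at least `1 / 2`. Integrating first in the variable that carries this
coefficient keeps the Jacobian below `2 ^ n`, uniformly in `t`. -/
theorem lintegral_lintegral_comp_segment_le {f : E → ℝ≥0∞} (hf : Measurable f) (B : Set E)
    (t : ℝ) :
    ∫⁻ x in B, ∫⁻ y in B, f ((1 - t) • x + t • y) ∂μ ∂μ ≤
      2 ^ Module.finrank ℝ E * μ B * ∫⁻ x, f x ∂μ := by
  have key : ∀ s : ℝ, 1 / 2 ≤ s → ∫⁻ x in B, ∫⁻ y in B, f ((1 - s) • x + s • y) ∂μ ∂μ ≤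
      2 ^ Module.finrank ℝ E * μ B * ∫⁻ x, f x ∂μ := fun s hs => by
    calc ∫⁻ x in B, ∫⁻ y in B, f ((1 - s) • x + s • y) ∂μ ∂μ
        ≤ ∫⁻ x in B, 2 ^ Module.finrank ℝ E * ∫⁻ x, f x ∂μ ∂μ :=
          lintegral_mono fun x =>
            (setLIntegral_le_lintegral _ _).trans (lintegral_comp_add_smul_le μ _ hs)
      _ = _ := by rw [setLIntegral_const]; ring
  rcases le_total (1 / 2) t with ht | ht
  · exact key t ht
  · rw [lintegral_lintegral_swap]
    · refine le_trans (le_of_eq ?_) (key (1 - t) (by linarith))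
      simp only [sub_sub_cancel, add_comm]
    · exact (hf.comp (by fun_prop)).aemeasurable

theorem lintegral_lintegral_enorm_sub_sq_ball_le {u : E → ℝ} (hu : ContDiff ℝ 1 u) (l : ℝ) :
    ∫⁻ x in Metric.ball (0 : E) l, ∫⁻ y in Metric.ball (0 : E) l, ‖u x - u y‖ₑ ^ 2 ∂μ ∂μ ≤
      ENNReal.ofReal (2 * l) ^ 2 * 2 ^ Module.finrank ℝ E * μ (Metric.ball 0 l) *
        ∫⁻ x in Metric.ball (0 : E) l, ‖fderiv ℝ u x‖ₑ ^ 2 ∂μ := by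
  set B := Metric.ball (0 : E) l with hB
  have hBm : MeasurableSet B := Metric.isOpen_ball.measurableSet
  -- Extension by zero costs nothing, since segments between points of the ball stay in it, and it
  -- allows changes of variables over the whole space.
  set G : E → ℝ≥0∞ := B.indicator fun x => ‖fderiv ℝ u x‖ₑ ^ 2 with hG
  have hcd : Continuous (fderiv ℝ u) := hu.continuous_fderiv one_ne_zero
  have hGm : Measurable G := (hcd.measurable.enorm.pow_const 2).indicator hBm
  have hpt : ∀ x ∈ B, ∀ y ∈ B, ‖u x - u y‖ₑ ^ 2 ≤
      ENNReal.ofReal (2 * l) ^ 2 * ∫⁻ t in Ioc (0 : ℝ) 1, G ((1 - t) • x + t • y) := by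
    intro x hx y hy
    refine (enorm_sub_sq_le_lintegral_segment hu x y).trans ?_
    refine mul_le_mul' (pow_le_pow_left' ?_ 2) ?_
    · rw [← ofReal_norm]
      refine ENNReal.ofReal_le_ofReal ((norm_sub_le _ _).trans ?_)
      have := mem_ball_zero_iff.1 hx
      have := mem_ball_zero_iff.1 hy
      linarith
    · refine setLIntegral_mono' measurableSet_Ioc fun t ht => ?_
      rw [hG, indicator_of_mem]
      exact convex_ball (0 : E) l hx hy (by linarith [ht.2]) ht.1.le (by ring)
  calc ∫⁻ x in B, ∫⁻ y in B, ‖u x - u y‖ₑ ^ 2 ∂μ ∂μ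
      ≤ ∫⁻ x in B, ∫⁻ y in B, ENNReal.ofReal (2 * l) ^ 2 *
          (∫⁻ t in Ioc (0 : ℝ) 1, G ((1 - t) • x + t • y)) ∂μ ∂μ :=
        setLIntegral_mono' hBm fun x hx => setLIntegral_mono' hBm fun y hy => hpt x hx y hy
    _ = ENNReal.ofReal (2 * l) ^ 2 *
          ∫⁻ x in B, ∫⁻ y in B, (∫⁻ t in Ioc (0 : ℝ) 1, G ((1 - t) • x + t • y)) ∂μ ∂μ := by
        simp_rw [lintegral_const_mul' (ENNReal.ofReal (2 * l) ^ 2) _ (by finiteness)]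
    _ = ENNReal.ofReal (2 * l) ^ 2 *
          ∫⁻ x in B, (∫⁻ t in Ioc (0 : ℝ) 1, (∫⁻ y in B, G ((1 - t) • x + t • y) ∂μ)) ∂μ := by
        congr 1
        refine lintegral_congr fun x => lintegral_lintegral_swap ?_
        exact (hGm.comp (by fun_prop)).aemeasurable
    _ = ENNReal.ofReal (2 * l) ^ 2 *
          ∫⁻ t in Ioc (0 : ℝ) 1, ∫⁻ x in B, ∫⁻ y in B, G ((1 - t) • x + t • y) ∂μ ∂μ := by
        congr 1
        refine lintegral_lintegral_swap ?_
        refine Measurable.aemeasurable ?_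
        refine Measurable.lintegral_prod_right' (f := fun p : (E × ℝ) × E =>
          G ((1 - p.1.2) • p.1.1 + p.1.2 • p.2)) ?_
        exact hGm.comp (by fun_prop)
    _ ≤ ENNReal.ofReal (2 * l) ^ 2 *
          ∫⁻ t in Ioc (0 : ℝ) 1, 2 ^ Module.finrank ℝ E * μ B * ∫⁻ x, G x ∂μ := by
        gcongr with t
        exact lintegral_lintegral_comp_segment_le μ hGm B t
    _ = _ := by
        rw [setLIntegral_const, Real.volume_Ioc, sub_zero, ENNReal.ofReal_one, mul_one,
          lintegral_indicator hBm]
        ring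

/-- Jensen's inequality reduces this to the double integral of differences. What matters later is
that the constant is a dimensional multiple of `l ^ 2`. -/
theorem lintegral_enorm_sub_average_sq_ball_le {u : E → ℝ} (hu : ContDiff ℝ 1 u) {l : ℝ}
    (hl : 0 < l) :
    ∫⁻ x in Metric.ball (0 : E) l, ‖u x - ⨍ y in Metric.ball (0 : E) l, u y ∂μ‖ₑ ^ 2 ∂μ ≤
      ENNReal.ofReal (2 * l) ^ 2 * 2 ^ Module.finrank ℝ E *
        ∫⁻ x in Metric.ball (0 : E) l, ‖fderiv ℝ u x‖ₑ ^ 2 ∂μ := by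
  set B := Metric.ball (0 : E) l with hB
  have hB0 : μ B ≠ 0 := (Metric.measure_ball_pos μ 0 hl).ne'
  have hBt : μ B ≠ ⊤ := measure_ball_lt_top.ne
  have : IsFiniteMeasure (μ.restrict B) := ⟨by simpa using hBt.lt_top⟩
  have : NeZero (μ.restrict B) := ⟨by simpa using hB0⟩
  have hint : IntegrableOn u B μ :=
    (hu.continuous.continuousOn.integrableOn_compact (isCompact_closedBall (0 : E) l)).mono_set
      Metric.ball_subset_closedBall
  calc ∫⁻ x in B, ‖u x - ⨍ y in B, u y ∂μ‖ₑ ^ 2 ∂μ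
      ≤ ∫⁻ x in B, (μ B)⁻¹ * ∫⁻ y in B, ‖u x - u y‖ₑ ^ 2 ∂μ ∂μ := by
        refine lintegral_mono fun x => ?_
        simpa using enorm_sub_average_sq_le hint (u x)
    _ = (μ B)⁻¹ * ∫⁻ x in B, ∫⁻ y in B, ‖u x - u y‖ₑ ^ 2 ∂μ ∂μ :=
        lintegral_const_mul' _ _ (by simpa using hB0)
    _ ≤ (μ B)⁻¹ * (ENNReal.ofReal (2 * l) ^ 2 * 2 ^ Module.finrank ℝ E * μ B *
        ∫⁻ x in B, ‖fderiv ℝ u x‖ₑ ^ 2 ∂μ) := by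
        gcongr
        exact lintegral_lintegral_enorm_sub_sq_ball_le μ hu l
    _ = ((μ B)⁻¹ * μ B) * (ENNReal.ofReal (2 * l) ^ 2 * 2 ^ Module.finrank ℝ E *
        ∫⁻ x in B, ‖fderiv ℝ u x‖ₑ ^ 2 ∂μ) := by ring
    _ = _ := by rw [ENNReal.inv_mul_cancel hB0 hBt, one_mul]

end Poincare

/-! ### Hardy's inequality with weight `1 / (1 + |x|²)` -/

section Hardy

variable {d : ℕ}

theorem fderiv_coord_div_one_add_norm_sq (i : Fin d) (x : EuclideanSpace ℝ (Fin d)) :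
    fderiv ℝ (fun x : EuclideanSpace ℝ (Fin d) => x i / (1 + ‖x‖ ^ 2)) x
      (EuclideanSpace.single i 1) =
      1 / (1 + ‖x‖ ^ 2) - 2 * x i ^ 2 / (1 + ‖x‖ ^ 2) ^ 2 := by
  have h0 : (1 + ‖x‖ ^ 2) ≠ 0 := by positivity
  have h1 : HasFDerivAt (fun x : EuclideanSpace ℝ (Fin d) => x i)
      (EuclideanSpace.proj i : EuclideanSpace ℝ (Fin d) →L[ℝ] ℝ) x :=
    (EuclideanSpace.proj i : EuclideanSpace ℝ (Fin d) →L[ℝ] ℝ).hasFDerivAt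
  have h2 : HasFDerivAt (fun x : EuclideanSpace ℝ (Fin d) => 1 + ‖x‖ ^ 2)
      (2 • innerSL ℝ x) x := ((hasStrictFDerivAt_norm_sq x).hasFDerivAt).const_add 1
  have h3 := h1.mul ((hasDerivAt_inv h0).comp_hasFDerivAt x h2)
  rw [show (fun x : EuclideanSpace ℝ (Fin d) => x i / (1 + ‖x‖ ^ 2)) =
    (fun x => x i) * (Inv.inv ∘ fun x => 1 + ‖x‖ ^ 2) from rfl, h3.fderiv]
  simp [EuclideanSpace.inner_single_right]
  field_simp
  ring

theorem contDiff_coord_div_one_add_norm_sq (i : Fin d) :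
    ContDiff ℝ ∞ (fun x : EuclideanSpace ℝ (Fin d) => x i / (1 + ‖x‖ ^ 2)) := by
  exact ContDiff.div (by fun_prop) (contDiff_const.add (contDiff_norm_sq ℝ)) fun x => by positivity

/-- One coordinate of the integration by parts of `u ^ 2` against the vector field `x / (1 + |x|²)`.
-/
theorem integral_sq_mul_div_eq {u : EuclideanSpace ℝ (Fin d) → ℝ} (hu : ContDiff ℝ 1 u)
    (hc : HasCompactSupport u) (i : Fin d) :
    ∫ x, u x ^ 2 * (1 / (1 + ‖x‖ ^ 2) - 2 * x i ^ 2 / (1 + ‖x‖ ^ 2) ^ 2) =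
      -∫ x, 2 * u x * fderiv ℝ u x (EuclideanSpace.single i 1) * (x i / (1 + ‖x‖ ^ 2)) := by
  have hu2 : ContDiff ℝ 1 fun x => u x ^ 2 := hu.pow 2
  have hc2 : HasCompactSupport fun x => u x ^ 2 := 
    hc.comp_left (g := fun t : ℝ => t ^ 2) (by simp)
  have hF := contDiff_coord_div_one_add_norm_sq i
  have hd : ∀ x, fderiv ℝ (fun x => u x ^ 2) x (EuclideanSpace.single i 1) =
      2 * u x * fderiv ℝ u x (EuclideanSpace.single i 1) := fun x => by
    rw [((hu.differentiable one_ne_zero x).hasFDerivAt.pow 2).fderiv]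
    simp
  have h := integral_mul_fderiv_eq_neg_fderiv_mul_of_integrable (μ := volume)
    (f := fun x : EuclideanSpace ℝ (Fin d) => u x ^ 2)
    (g := fun x : EuclideanSpace ℝ (Fin d) => x i / (1 + ‖x‖ ^ 2))
    (v := EuclideanSpace.single i 1) ?_ ?_ ?_ ?_ ?_
  · simpa only [hd, fderiv_coord_div_one_add_norm_sq] using h
  · exact (((hu2.continuous_fderiv one_ne_zero).clm_apply continuous_const).mul
      hF.continuous).integrable_of_hasCompactSupport ((hc2.fderiv_apply ℝ _).mul_right)
  · exact (hu2.continuous.mul ((hF.continuous_fderiv (by simp)).clm_apply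
      continuous_const)).integrable_of_hasCompactSupport hc2.mul_right
  · exact (hu2.continuous.mul hF.continuous).integrable_of_hasCompactSupport hc2.mul_right
  · exact fun x _ => hu2.differentiable one_ne_zero x
  · exact fun x _ => hF.differentiable (by simp) x

/-- A form of Hardy's inequality, with the weight regularised at the origin. -/
theorem integral_sq_div_one_add_norm_sq_le (hd : 3 ≤ d) {u : EuclideanSpace ℝ (Fin d) → ℝ}
    (hu : ContDiff ℝ 1 u) (hc : HasCompactSupport u) :
    ∫ x, u x ^ 2 / (1 + ‖x‖ ^ 2) ≤ 4 * ∫ x, ‖fderiv ℝ u x‖ ^ 2 := by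
  have hpos : ∀ x : EuclideanSpace ℝ (Fin d), (1 + ‖x‖ ^ 2) ≠ 0 := fun x => by positivity
  have hc2 : HasCompactSupport fun x => u x ^ 2 := 
    hc.comp_left (g := fun t : ℝ => t ^ 2) (by simp)
  have hu2 : Continuous fun x => u x ^ 2 := hu.continuous.pow 2
  have hcd := hu.continuous_fderiv one_ne_zero
  have hsum := Finset.sum_congr (rfl : (Finset.univ : Finset (Fin d)) = Finset.univ)
    fun i _ => integral_sq_mul_div_eq hu hc i
  have hi1 : ∀ i : Fin d, Integrable fun x : EuclideanSpace ℝ (Fin d) =>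
      u x ^ 2 * (1 / (1 + ‖x‖ ^ 2) - 2 * x i ^ 2 / (1 + ‖x‖ ^ 2) ^ 2) := fun i => by
    refine Continuous.integrable_of_hasCompactSupport (hu2.mul ?_) hc2.mul_right
    exact (continuous_const.div (by fun_prop) hpos).sub
      (Continuous.div (by fun_prop) (by fun_prop) fun x => pow_ne_zero 2 (hpos x))
  have hi2 : ∀ i : Fin d, Integrable fun x : EuclideanSpace ℝ (Fin d) =>
      2 * u x * fderiv ℝ u x (EuclideanSpace.single i 1) * (x i / (1 + ‖x‖ ^ 2)) := fun i => by
    have : Continuous fun x => u x := hu.continuous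
    refine Continuous.integrable_of_hasCompactSupport (Continuous.mul (by fun_prop) ?_) ?_
    · exact (contDiff_coord_div_one_add_norm_sq i).continuous
    · exact ((hc.mul_left (f := fun _ => (2 : ℝ))).mul_right).mul_right
  rw [Finset.sum_neg_distrib, ← integral_finsetSum _ fun i _ => hi1 i,
    ← integral_finsetSum _ fun i _ => hi2 i] at hsum
  have hl : ∀ x : EuclideanSpace ℝ (Fin d), ∑ i, u x ^ 2 * (1 / (1 + ‖x‖ ^ 2) -
      2 * x i ^ 2 / (1 + ‖x‖ ^ 2) ^ 2) =
      u x ^ 2 * (d / (1 + ‖x‖ ^ 2) - 2 * ‖x‖ ^ 2 / (1 + ‖x‖ ^ 2) ^ 2) := fun x => by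
    rw [← Finset.mul_sum, Finset.sum_sub_distrib, ← Finset.sum_div, ← Finset.sum_div,
      ← Finset.mul_sum, ← EuclideanSpace.real_norm_sq_eq x]
    simp
  have hr : ∀ x : EuclideanSpace ℝ (Fin d), ∑ i, 2 * u x *
      fderiv ℝ u x (EuclideanSpace.single i 1) * (x i / (1 + ‖x‖ ^ 2)) =
      2 * u x * fderiv ℝ u x x / (1 + ‖x‖ ^ 2) := fun x => by
    have hx : ∑ i, x i • (EuclideanSpace.single i (1 : ℝ)) = x := by
      ext j
      simp [Pi.single_apply]
    have hx' : fderiv ℝ u x x = ∑ i, x i * fderiv ℝ u x (EuclideanSpace.single i 1) := by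
      conv_lhs => enter [2]; rw [← hx]
      simp only [map_sum, map_smul, smul_eq_mul]
    rw [hx', Finset.mul_sum, Finset.sum_div]
    exact Finset.sum_congr rfl fun i _ => by ring
  simp only [hl, hr] at hsum
  have iA : Integrable fun x : EuclideanSpace ℝ (Fin d) => u x ^ 2 / (1 + ‖x‖ ^ 2) :=
    Continuous.integrable_of_hasCompactSupport (hu2.div (by fun_prop) hpos)
      (by simp only [div_eq_mul_inv]; exact hc2.mul_right)
  have iB : Integrable fun x => ‖fderiv ℝ u x‖ ^ 2 :=
    Continuous.integrable_of_hasCompactSupport (by fun_prop)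
      ((hc.fderiv ℝ).comp_left (g := fun L => ‖L‖ ^ 2) (by simp))
  have iL : Integrable fun x : EuclideanSpace ℝ (Fin d) =>
      u x ^ 2 * (d / (1 + ‖x‖ ^ 2) - 2 * ‖x‖ ^ 2 / (1 + ‖x‖ ^ 2) ^ 2) :=
    (integrable_finsetSum _ fun i _ => hi1 i).congr (Eventually.of_forall hl)
  have iR : Integrable fun x : EuclideanSpace ℝ (Fin d) =>
      2 * u x * fderiv ℝ u x x / (1 + ‖x‖ ^ 2) :=
    (integrable_finsetSum _ fun i _ => hi2 i).congr (Eventually.of_forall hr)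
  -- The divergence of the field is at least `(d - 2) / (1 + |x|²)`; this is where `d ≥ 3` enters.
  have e1 : ∫ x, u x ^ 2 / (1 + ‖x‖ ^ 2) ≤
      ∫ x, u x ^ 2 * (d / (1 + ‖x‖ ^ 2) - 2 * ‖x‖ ^ 2 / (1 + ‖x‖ ^ 2) ^ 2) := by
    refine integral_mono iA iL fun x => ?_
    have h3 : (3 : ℝ) ≤ d := by exact_mod_cast hd
    have h4 : (1 : ℝ) / (1 + ‖x‖ ^ 2) ≤
        d / (1 + ‖x‖ ^ 2) - 2 * ‖x‖ ^ 2 / (1 + ‖x‖ ^ 2) ^ 2 := by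
      rw [div_sub_div _ _ (hpos x) (pow_ne_zero 2 (hpos x)), div_le_div_iff₀ (by positivity)
        (by positivity)]
      have : 0 ≤ ‖x‖ ^ 2 := by positivity
      have h5 : (1 + ‖x‖ ^ 2) * 2 * ‖x‖ ^ 2 ≤ (d - 1) * (1 + ‖x‖ ^ 2) ^ 2 := by nlinarith
      nlinarith
    simpa [div_eq_mul_inv] using mul_le_mul_of_nonneg_left h4 (sq_nonneg (u x))
  -- Young's inequality with weights `1 / 2` and `2`: half of the left side is absorbed, which
  -- leaves the constant `4`.
  have e2 : -∫ x, 2 * u x * fderiv ℝ u x x / (1 + ‖x‖ ^ 2) ≤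
      ∫ x, ((1 / 2) * (u x ^ 2 / (1 + ‖x‖ ^ 2)) + 2 * ‖fderiv ℝ u x‖ ^ 2) := by
    rw [← integral_neg]
    refine integral_mono iR.neg ((iA.const_mul _).add (iB.const_mul _)) fun x => ?_
    have h1 : |fderiv ℝ u x x| ≤ ‖fderiv ℝ u x‖ * ‖x‖ := (fderiv ℝ u x).le_opNorm x
    have h2 : -(2 * u x * fderiv ℝ u x x) ≤
        (1 / 2) * u x ^ 2 + 2 * (‖fderiv ℝ u x‖ * ‖x‖) ^ 2 := by
      have := sq_le_sq.2 (h1.trans (le_abs_self _))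
      nlinarith [sq_nonneg (u x + 2 * fderiv ℝ u x x)]
    have h3 : (‖fderiv ℝ u x‖ * ‖x‖) ^ 2 ≤ ‖fderiv ℝ u x‖ ^ 2 * (1 + ‖x‖ ^ 2) := by
      nlinarith [sq_nonneg ‖fderiv ℝ u x‖]
    change -(2 * u x * fderiv ℝ u x x / (1 + ‖x‖ ^ 2)) ≤ _
    rw [← neg_div, div_le_iff₀ (by positivity), add_mul, mul_assoc (1 / 2 : ℝ),
      div_mul_cancel₀ _ (hpos x)]
    linarith
  rw [integral_add (iA.const_mul _) (iB.const_mul _), integral_const_mul,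
    integral_const_mul] at e2
  linarith

end Hardy

/-! ### Hardy's inequality for the deviation from the mean -/

section SliceInequality

variable {d : ℕ}

theorem lintegral_enorm_sq_mul_le (hd : 3 ≤ d) {u : EuclideanSpace ℝ (Fin d) → ℝ}
    (hu : ContDiff ℝ 1 u) (hc : HasCompactSupport u) :
    ∫⁻ x, ‖u x‖ₑ ^ 2 * ENNReal.ofReal (1 / (1 + ‖x‖ ^ 2)) ≤
      4 * ∫⁻ x, ‖fderiv ℝ u x‖ₑ ^ 2 := by
  have hcd := hu.continuous_fderiv one_ne_zero
  have hc2 : HasCompactSupport fun x => u x ^ 2 :=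
    hc.comp_left (g := fun t : ℝ => t ^ 2) (by simp)
  have hpos : ∀ x : EuclideanSpace ℝ (Fin d), (1 + ‖x‖ ^ 2) ≠ 0 := fun x => by positivity
  have iA : Integrable fun x : EuclideanSpace ℝ (Fin d) => u x ^ 2 / (1 + ‖x‖ ^ 2) :=
    Continuous.integrable_of_hasCompactSupport
      ((hu.continuous.pow 2).div (by fun_prop) hpos)
      (by simp only [div_eq_mul_inv]; exact hc2.mul_right)
  have iB : Integrable fun x => ‖fderiv ℝ u x‖ ^ 2 :=
    Continuous.integrable_of_hasCompactSupport (by fun_prop)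
      ((hc.fderiv ℝ).comp_left (g := fun L => ‖L‖ ^ 2) (by simp))
  have e1 : ∀ x, ‖u x‖ₑ ^ 2 * ENNReal.ofReal (1 / (1 + ‖x‖ ^ 2)) =
      ENNReal.ofReal (u x ^ 2 / (1 + ‖x‖ ^ 2)) := fun x => by
    rw [← ofReal_norm, ← ENNReal.ofReal_pow (norm_nonneg _), ← ENNReal.ofReal_mul (by positivity),
      Real.norm_eq_abs, sq_abs, mul_one_div]
  have e2 : ∀ x, ‖fderiv ℝ u x‖ₑ ^ 2 = ENNReal.ofReal (‖fderiv ℝ u x‖ ^ 2) := fun x => by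
    rw [← ofReal_norm, ← ENNReal.ofReal_pow (norm_nonneg _)]
  simp_rw [e1, e2]
  rw [← ofReal_integral_eq_lintegral_ofReal iA (Eventually.of_forall fun x => by positivity),
    ← ofReal_integral_eq_lintegral_ofReal iB (Eventually.of_forall fun x => by positivity)]
  refine (ENNReal.ofReal_le_ofReal (integral_sq_div_one_add_norm_sq_le hd hu hc)).trans_eq ?_
  rw [ENNReal.ofReal_mul (by norm_num)]
  simp

/-- Hardy's inequality for the deviation from the mean over a ball, up to the half ball. -/
theorem exists_lintegral_sub_average_sq_mul_le (hd : 3 ≤ d) :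
    ∃ C : ℝ≥0∞, C ≠ ⊤ ∧ ∀ l : ℝ, 0 < l → ∀ u : EuclideanSpace ℝ (Fin d) → ℝ, ContDiff ℝ 1 u →
      ∫⁻ x in Metric.ball 0 (l / 2), ‖u x - ⨍ y in Metric.ball 0 l, u y‖ₑ ^ 2 *
        ENNReal.ofReal (1 / (1 + ‖x‖ ^ 2)) ≤
      C * ∫⁻ x in Metric.ball 0 l, ‖fderiv ℝ u x‖ₑ ^ 2 := by
  let χ : ContDiffBump (0 : EuclideanSpace ℝ (Fin d)) := ⟨1 / 2, 3 / 4, by norm_num, by norm_num⟩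
  have hχ : ContDiff ℝ 1 χ := χ.contDiff
  obtain ⟨M, hM⟩ := (hχ.continuous_fderiv one_ne_zero).bounded_above_of_compact_support
    (χ.hasCompactSupport.fderiv ℝ)
  have hM0 : 0 ≤ M := (norm_nonneg _).trans (hM 0)
  -- The `4` is Hardy's constant, both inner `2`s come from squaring a sum, `M` bounds the gradient
  -- of the unscaled cutoff, and the last factor is Poincaré's constant without its `l ^ 2`.
  refine ⟨4 * (2 + 2 * ENNReal.ofReal M ^ 2 * (ENNReal.ofReal 2 ^ 2 * 2 ^ d)), by finiteness,
    fun l hl u hu => ?_⟩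
  set m := ⨍ y in Metric.ball 0 l, u y with hm
  set B := Metric.ball (0 : EuclideanSpace ℝ (Fin d)) l with hB
  set I := ∫⁻ x in B, ‖fderiv ℝ u x‖ₑ ^ 2 with hI
  set ψ : EuclideanSpace ℝ (Fin d) → ℝ := fun x => χ (l⁻¹ • x) with hψ
  have hψc : ContDiff ℝ 1 ψ := hχ.comp (contDiff_const_smul _)
  have hψd : ∀ x, ‖fderiv ℝ ψ x‖ ≤ M / l := fun x => by
    rw [hψ, fderiv_comp_smul, norm_smul, norm_inv, Real.norm_of_nonneg hl.le, ← div_eq_inv_mul]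
    gcongr
    exact hM _
  have hψ1 : ∀ x ∈ Metric.ball (0 : EuclideanSpace ℝ (Fin d)) (l / 2), ψ x = 1 := fun x hx => by
    refine χ.one_of_mem_closedBall ?_
    rw [mem_closedBall_zero_iff, norm_smul, norm_inv, Real.norm_of_nonneg hl.le,
      inv_mul_le_iff₀ hl]
    have := mem_ball_zero_iff.1 hx
    change ‖x‖ ≤ l * (1 / 2)
    linarith
  -- The radius `3 / 4` leaves a margin, so the support of the cutoff function `z` lies in the open
  -- ball where Poincaré's inequality holds.
  have hψ0 : tsupport ψ ⊆ Metric.closedBall 0 (l * (3 / 4)) := by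
    refine closure_minimal (fun x hx => ?_) Metric.isClosed_closedBall
    by_contra h
    refine hx (χ.zero_of_le_dist ?_)
    rw [mem_closedBall_zero_iff, not_le] at h
    rw [dist_zero_right, norm_smul, norm_inv, Real.norm_of_nonneg hl.le, le_inv_mul_iff₀ hl]
    exact h.le
  have hψs : HasCompactSupport ψ :=
    (isCompact_closedBall _ _).of_isClosed_subset (isClosed_tsupport _) hψ0
  set z : EuclideanSpace ℝ (Fin d) → ℝ := fun x => ψ x * (u x - m) with hz
  have hzc : ContDiff ℝ 1 z := hψc.mul (hu.sub contDiff_const)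
  have hzs : HasCompactSupport z := hψs.mul_right
  have hzd : ∀ x ∈ B, ‖fderiv ℝ z x‖ₑ ^ 2 ≤ 2 * ‖fderiv ℝ u x‖ₑ ^ 2 +
      2 * (ENNReal.ofReal (M / l) ^ 2 * ‖u x - m‖ₑ ^ 2) := fun x _ => by
    have h1 : fderiv ℝ z x = ψ x • fderiv ℝ u x + (u x - m) • fderiv ℝ ψ x := by
      rw [hz, fderiv_fun_mul (hψc.differentiable one_ne_zero x)
        ((hu.differentiable one_ne_zero x).sub_const m), fderiv_sub_const]
    have h2 : ‖ψ x‖ₑ ≤ 1 := by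
      rw [← ofReal_norm, Real.norm_of_nonneg χ.nonneg]
      exact ENNReal.ofReal_le_one.2 χ.le_one
    have h3 : ‖fderiv ℝ ψ x‖ₑ ≤ ENNReal.ofReal (M / l) := by
      rw [← ofReal_norm]
      exact ENNReal.ofReal_le_ofReal (hψd x)
    have h4 : ‖fderiv ℝ z x‖ₑ ≤ ‖fderiv ℝ u x‖ₑ + ENNReal.ofReal (M / l) * ‖u x - m‖ₑ := by
      rw [h1]
      refine (enorm_add_le (ψ x • fderiv ℝ u x) ((u x - m) • fderiv ℝ ψ x)).trans ?_
      rw [enorm_smul, enorm_smul, mul_comm ‖u x - m‖ₑ]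
      gcongr
      exact mul_le_of_le_one_left' h2
    refine (pow_le_pow_left' h4 2).trans ((ENNReal.add_sq_le_two_mul _ _).trans_eq ?_)
    rw [mul_pow]
  have hzt : ∫⁻ x, ‖fderiv ℝ z x‖ₑ ^ 2 = ∫⁻ x in B, ‖fderiv ℝ z x‖ₑ ^ 2 := by
    refine (setLIntegral_eq_of_support_subset fun x hx => ?_).symm
    have hx' : x ∈ tsupport (fderiv ℝ z) := subset_tsupport _ fun h => hx (by
      change ‖fderiv ℝ z x‖ₑ ^ 2 = 0
      rw [← ofReal_norm, h, norm_zero]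
      simp)
    have := hψ0 (tsupport_mul_subset_left (tsupport_fderiv_subset ℝ hx'))
    rw [mem_closedBall_zero_iff] at this
    rw [hB, mem_ball_zero_iff]
    linarith
  have hum : Measurable fun x => ‖fderiv ℝ u x‖ₑ ^ 2 :=
    ((hu.continuous_fderiv one_ne_zero).measurable.enorm.pow_const 2)
  have hpoin : ∫⁻ x in B, ‖u x - m‖ₑ ^ 2 ≤ ENNReal.ofReal (2 * l) ^ 2 * 2 ^ d * I := by
    simpa using lintegral_enorm_sub_average_sq_ball_le volume hu hl
  calc ∫⁻ x in Metric.ball 0 (l / 2), ‖u x - m‖ₑ ^ 2 * ENNReal.ofReal (1 / (1 + ‖x‖ ^ 2))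
      = ∫⁻ x in Metric.ball 0 (l / 2), ‖z x‖ₑ ^ 2 * ENNReal.ofReal (1 / (1 + ‖x‖ ^ 2)) := by
        refine setLIntegral_congr_fun measurableSet_ball fun x hx => ?_
        simp only [hz, hψ1 x hx, one_mul]
    _ ≤ ∫⁻ x, ‖z x‖ₑ ^ 2 * ENNReal.ofReal (1 / (1 + ‖x‖ ^ 2)) := setLIntegral_le_lintegral _ _
    _ ≤ 4 * ∫⁻ x in B, ‖fderiv ℝ z x‖ₑ ^ 2 :=
        (lintegral_enorm_sq_mul_le hd hzc hzs).trans_eq (by rw [hzt])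
    _ ≤ 4 * ∫⁻ x in B, (2 * ‖fderiv ℝ u x‖ₑ ^ 2 +
          2 * (ENNReal.ofReal (M / l) ^ 2 * ‖u x - m‖ₑ ^ 2)) := by
        gcongr 4 * ?_
        exact setLIntegral_mono' measurableSet_ball hzd
    _ = 4 * (2 * I + 2 * (ENNReal.ofReal (M / l) ^ 2 * ∫⁻ x in B, ‖u x - m‖ₑ ^ 2)) := by
        rw [lintegral_add_left (hum.const_mul 2), lintegral_const_mul' _ _ (by finiteness),
          lintegral_const_mul' _ _ (by finiteness), lintegral_const_mul' _ _ (by finiteness)]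
    _ ≤ 4 * (2 * I + 2 * (ENNReal.ofReal (M / l) ^ 2 *
          (ENNReal.ofReal (2 * l) ^ 2 * 2 ^ d * I))) := by gcongr
    _ = 4 * (2 + 2 * (ENNReal.ofReal (M / l) * ENNReal.ofReal l) ^ 2 *
          (ENNReal.ofReal 2 ^ 2 * 2 ^ d)) * I := by
        rw [ENNReal.ofReal_mul two_pos.le]
        ring
    -- The factor `l ^ 2` from Poincaré cancels the `(M / l) ^ 2` of the rescaled cutoff, so the
    -- constant is independent of `l`.
    _ = _ := by rw [← ENNReal.ofReal_mul (by positivity), div_mul_cancel₀ _ hl.ne']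

end SliceInequality

/-! ### A cutoff whose squared gradient is small against the Hardy weight -/

section Cutoff

theorem exists_norm_deriv_smoothTransition_le :
    ∃ M : ℝ, 0 < M ∧ ∀ x, ‖deriv Real.smoothTransition x‖ ≤ M := by
  have hc : Continuous (deriv Real.smoothTransition) :=
    (Real.smoothTransition.contDiff (n := 1)).continuous_deriv le_rfl
  obtain ⟨M, hM⟩ := (isCompact_Icc (a := (0 : ℝ)) (b := 1)).exists_bound_of_continuousOn
    hc.continuousOn
  refine ⟨max M 1, by positivity, fun x => ?_⟩
  rcases lt_or_ge x 0 with h | h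
  · have : Real.smoothTransition =ᶠ[𝓝 x] fun _ => 0 := by
      filter_upwards [Iio_mem_nhds h] with y hy
      exact Real.smoothTransition.zero_of_nonpos (le_of_lt hy)
    rw [this.deriv_eq]
    simp
  rcases lt_or_ge 1 x with h1 | h1
  · have : Real.smoothTransition =ᶠ[𝓝 x] fun _ => 1 := by
      filter_upwards [Ioi_mem_nhds h1] with y hy
      exact Real.smoothTransition.one_of_one_le (le_of_lt hy)
    rw [this.deriv_eq]
    simp
  · exact (hM x ⟨h, h1⟩).trans (le_max_left _ _)

/-- A logarithmic cutoff. -/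
theorem exists_log_cutoff {E : Type*} [NormedAddCommGroup E] [InnerProductSpace ℝ E]
    (R₀ : ℝ) {ε : ℝ} (hε : 0 < ε) :
    ∃ (R : ℝ) (η : E → ℝ), 0 < R ∧ ContDiff ℝ ∞ η ∧ (∀ x, η x ∈ Icc (0 : ℝ) 1) ∧
      (∀ x, ‖x‖ ≤ R₀ → η x = 1) ∧ (∀ x, R ≤ ‖x‖ → η x = 0) ∧
      ∀ x, ‖fderiv ℝ η x‖ ^ 2 ≤ ε / (1 + ‖x‖ ^ 2) := by
  obtain ⟨M, hM0, hM⟩ := exists_norm_deriv_smoothTransition_le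
  -- The gradient of `b log (1 + |x|²)` has norm `2 b |x| / (1 + |x|²)`, so this `b` makes the
  -- cutoff's gradient at most `√ε |x| / (1 + |x|²)`. The constant `a` below puts the argument of
  -- the transition above `1` on the ball of radius `R₀`.
  set b : ℝ := √ε / (2 * M) with hb
  have hb0 : 0 < b := by positivity
  set a : ℝ := 1 + b * Real.log (1 + R₀ ^ 2) with ha
  have hpos : ∀ x : E, 0 < 1 + ‖x‖ ^ 2 := fun x => by positivity
  have hns : ContDiff ℝ ∞ fun x : E => 1 + ‖x‖ ^ 2 := contDiff_const.add (contDiff_norm_sq ℝ)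
  have hlog : ContDiff ℝ ∞ fun x : E => a - b * Real.log (1 + ‖x‖ ^ 2) :=
    contDiff_const.sub (contDiff_const.mul (hns.log fun x => (hpos x).ne'))
  refine ⟨Real.exp (a / b), fun x => Real.smoothTransition (a - b * Real.log (1 + ‖x‖ ^ 2)),
    Real.exp_pos _, Real.smoothTransition.contDiff.comp hlog,
    fun x => ⟨Real.smoothTransition.nonneg _, Real.smoothTransition.le_one _⟩,
    fun x hx => Real.smoothTransition.one_of_one_le ?_,
    fun x hx => Real.smoothTransition.zero_of_nonpos ?_, fun x => ?_⟩
  · have : Real.log (1 + ‖x‖ ^ 2) ≤ Real.log (1 + R₀ ^ 2) :=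
      Real.log_le_log (hpos x) (by gcongr)
    rw [ha]
    nlinarith
  -- With `R = exp (a / b) ≥ 1` one has `1 + R² ≥ R`, so the logarithm already exceeds `a / b` at
  -- radius `R`.
  · have hR1 : 1 ≤ Real.exp (a / b) := by
      have : 0 ≤ Real.log (1 + R₀ ^ 2) := Real.log_nonneg (by nlinarith)
      exact Real.one_le_exp (by positivity)
    have : a / b ≤ Real.log (1 + ‖x‖ ^ 2) := by
      rw [Real.le_log_iff_exp_le (hpos x)]
      nlinarith
    rw [div_le_iff₀ hb0] at this
    linarith
  · have h1 : HasFDerivAt (fun x : E => a - b * Real.log (1 + ‖x‖ ^ 2))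
        (-(b • ((1 + ‖x‖ ^ 2)⁻¹ • (2 • innerSL ℝ x)))) x := by
      have h2 : HasFDerivAt (fun x : E => 1 + ‖x‖ ^ 2) (2 • innerSL ℝ x) x :=
        ((hasStrictFDerivAt_norm_sq x).hasFDerivAt).const_add 1
      exact ((h2.log (hpos x).ne').const_mul b).const_sub a
    have h3 := ((Real.smoothTransition.contDiff (n := 1)).differentiable one_ne_zero
      (a - b * Real.log (1 + ‖x‖ ^ 2))).hasDerivAt.comp_hasFDerivAt x h1
    have h4 : ‖fderiv ℝ (fun x : E => Real.smoothTransition (a - b * Real.log (1 + ‖x‖ ^ 2))) x‖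
        ≤ M * (b * ((1 + ‖x‖ ^ 2)⁻¹ * (2 * ‖x‖))) := by
      have h3' := h3.fderiv
      rw [Function.comp_def] at h3'
      rw [h3', norm_smul, norm_neg, norm_smul, norm_smul, ← Nat.cast_smul_eq_nsmul ℝ, norm_smul,
        innerSL_apply_norm, Real.norm_of_nonneg hb0.le, norm_inv, Real.norm_of_nonneg (hpos x).le]
      simp only [Nat.cast_ofNat, Real.norm_ofNat]
      gcongr
      exact hM _
    have h5 : M * (b * ((1 + ‖x‖ ^ 2)⁻¹ * (2 * ‖x‖))) = √ε * (‖x‖ / (1 + ‖x‖ ^ 2)) := by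
      rw [hb]
      field_simp
    rw [h5] at h4
    refine (pow_le_pow_left₀ (norm_nonneg _) h4 2).trans ?_
    rw [mul_pow, Real.sq_sqrt hε.le, div_eq_mul_inv ε]
    gcongr
    rw [div_pow, ← one_div, div_le_div_iff₀ (by positivity) (hpos x)]
    nlinarith [sq_nonneg ‖x‖]

end Cutoff

/-! ### Slicing the cylinder: Fubini and restriction of gradients -/

section Slices

theorem enorm_fderiv_comp_le {E F : Type*} [NormedAddCommGroup E] [NormedSpace ℝ E]
    [NormedAddCommGroup F] [NormedSpace ℝ F] {V : F → ℝ} (hV : ContDiff ℝ 1 V) {ι : E → F}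
    (hι : Differentiable ℝ ι) (hL : LipschitzWith 1 ι) (x : E) :
    ‖fderiv ℝ (fun y => V (ι y)) x‖ₑ ≤ ‖fderiv ℝ V (ι x)‖ₑ := by
  rw [← ofReal_norm, ← ofReal_norm]
  refine ENNReal.ofReal_le_ofReal ?_
  rw [show (fun y => V (ι y)) = V ∘ ι from rfl,
    fderiv_comp x (hV.differentiable one_ne_zero _) (hι x)]
  refine (ContinuousLinearMap.opNorm_comp_le _ _).trans ?_
  have := norm_fderiv_le_of_lipschitz ℝ (x₀ := x) hL
  exact mul_le_of_le_one_right (norm_nonneg _) (by simpa using this)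

variable {N : ℕ}

theorem contDiff_toLp_left (t : ℝ) {n : ℕ∞ω} :
    ContDiff ℝ n
      (fun x : EuclideanSpace ℝ (Fin (N - 1)) => (WithLp.toLp 2 (x, t) : SplitSpace N)) :=
  (WithLp.prodContinuousLinearEquiv 2 ℝ (EuclideanSpace ℝ (Fin (N - 1))) ℝ).symm.contDiff.comp
    (contDiff_id.prodMk contDiff_const)

theorem contDiff_toLp_right (x : EuclideanSpace ℝ (Fin (N - 1))) {n : ℕ∞ω} :
    ContDiff ℝ n (fun t : ℝ => (WithLp.toLp 2 (x, t) : SplitSpace N)) :=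
  (WithLp.prodContinuousLinearEquiv 2 ℝ (EuclideanSpace ℝ (Fin (N - 1))) ℝ).symm.contDiff.comp
    (contDiff_const.prodMk contDiff_id)

theorem lipschitzWith_toLp_left (t : ℝ) :
    LipschitzWith 1
      (fun x : EuclideanSpace ℝ (Fin (N - 1)) => (WithLp.toLp 2 (x, t) : SplitSpace N)) :=
  LipschitzWith.mk_one fun x y => by
    rw [WithLp.prod_dist_eq_of_L2]
    simp [Real.sqrt_sq]

theorem lipschitzWith_toLp_right (x : EuclideanSpace ℝ (Fin (N - 1))) :
    LipschitzWith 1 (fun t : ℝ => (WithLp.toLp 2 (x, t) : SplitSpace N)) :=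
  LipschitzWith.mk_one fun s t => by
    rw [WithLp.prod_dist_eq_of_L2]
    simp [Real.sqrt_sq]

theorem isOpen_openCylinder (l h : ℝ) : IsOpen (openCylinder N l h) :=
  (Metric.isOpen_ball.preimage (WithLp.continuous_fst 2 _ _)).inter
    (isOpen_Ioo.preimage (WithLp.continuous_snd 2 _ _))

theorem measurable_toLp_prod :
    Measurable fun p : EuclideanSpace ℝ (Fin (N - 1)) × ℝ => (WithLp.toLp 2 p : SplitSpace N) :=
  (WithLp.volume_preserving_toLp _ _).measurable

theorem preimage_toLp_openCylinder (l h : ℝ) :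
    WithLp.toLp 2 ⁻¹' openCylinder N l h =
      Metric.ball (0 : EuclideanSpace ℝ (Fin (N - 1))) l ×ˢ Ioo (-h) h := rfl

theorem lintegral_openCylinder (l h : ℝ) {f : SplitSpace N → ℝ≥0∞} (hf : Measurable f) :
    ∫⁻ p in openCylinder N l h, f p =
      ∫⁻ t in Ioo (-h) h, ∫⁻ x in Metric.ball (0 : EuclideanSpace ℝ (Fin (N - 1))) l,
        f (WithLp.toLp 2 (x, t)) := by
  rw [← (WithLp.volume_preserving_toLp _ _).setLIntegral_comp_preimage
    (isOpen_openCylinder l h).measurableSet hf, preimage_toLp_openCylinder,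
    Measure.volume_eq_prod, ← Measure.prod_restrict,
    lintegral_prod_symm']
  exact hf.comp measurable_toLp_prod

theorem lintegral_openCylinder' (l h : ℝ) {f : SplitSpace N → ℝ≥0∞} (hf : Measurable f) :
    ∫⁻ p in openCylinder N l h, f p =
      ∫⁻ x in Metric.ball (0 : EuclideanSpace ℝ (Fin (N - 1))) l, ∫⁻ t in Ioo (-h) h,
        f (WithLp.toLp 2 (x, t)) := by
  rw [lintegral_openCylinder l h hf, lintegral_lintegral_swap]
  exact (hf.comp (measurable_toLp_prod.comp measurable_swap)).aemeasurable

theorem volume_openCylinder (l h : ℝ) :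
    volume (openCylinder N l h) =
      volume (Metric.ball (0 : EuclideanSpace ℝ (Fin (N - 1))) l) * volume (Ioo (-h) h) := by
  rw [← (WithLp.volume_preserving_toLp _ _).measure_preimage
    (isOpen_openCylinder l h).measurableSet.nullMeasurableSet, preimage_toLp_openCylinder,
    Measure.volume_eq_prod, Measure.prod_prod]

theorem integrableOn_openCylinder_of_continuous (l h : ℝ) {V : SplitSpace N → ℝ}
    (hV : Continuous V) : IntegrableOn V (openCylinder N l h) := by
  refine (hV.continuousOn.integrableOn_compact
    (isCompact_closedBall (0 : SplitSpace N) (|l| + |h|))).mono_set fun p hp => ?_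
  have h1 := mem_ball_zero_iff.1 hp.1
  have h2 := abs_lt.2 hp.2
  rw [mem_closedBall_zero_iff, WithLp.prod_norm_eq_of_L2]
  refine Real.sqrt_le_iff.2 ⟨by positivity, ?_⟩
  have h3 : ‖p.fst‖ ^ 2 ≤ |l| ^ 2 := by
    gcongr
    exact h1.le.trans (le_abs_self l)
  have h4 : ‖p.snd‖ ^ 2 ≤ |h| ^ 2 := by
    gcongr
    exact h2.le.trans (le_abs_self h)
  nlinarith [mul_nonneg (abs_nonneg l) (abs_nonneg h)]

theorem average_openCylinder (l h : ℝ) {V : SplitSpace N → ℝ} (hV : Continuous V) :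
    ⨍ p in openCylinder N l h, V p =
      ⨍ x in Metric.ball (0 : EuclideanSpace ℝ (Fin (N - 1))) l, ⨍ t in Ioo (-h) h,
        V (WithLp.toLp 2 (x, t)) := by
  have hint := integrableOn_openCylinder_of_continuous l h hV
  have hme : MeasurableEmbedding
      (fun p : EuclideanSpace ℝ (Fin (N - 1)) × ℝ => (WithLp.toLp 2 p : SplitSpace N)) :=
    (MeasurableEquiv.toLp 2 _).measurableEmbedding
  have h1 : ∫ p in openCylinder N l h, V p =
      ∫ x in Metric.ball (0 : EuclideanSpace ℝ (Fin (N - 1))) l, ∫ t in Ioo (-h) h,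
        V (WithLp.toLp 2 (x, t)) := by
    have hmp := WithLp.volume_preserving_toLp (EuclideanSpace ℝ (Fin (N - 1))) ℝ
    rw [← hmp.setIntegral_preimage_emb hme, preimage_toLp_openCylinder,
      Measure.volume_eq_prod, setIntegral_prod]
    rw [← Measure.volume_eq_prod, ← preimage_toLp_openCylinder]
    exact (hmp.integrableOn_comp_preimage hme).2 hint
  simp_rw [setAverage_eq, smul_eq_mul]
  rw [h1, integral_const_mul, measureReal_def, volume_openCylinder, ENNReal.toReal_mul, mul_inv,
    mul_assoc]
  rfl

end Slices

/-! ### Oscillation of the slice means -/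

section Vertical

variable {N : ℕ}

/-- The means over the horizontal slices differ little from the mean over the cylinder. -/
theorem enorm_slice_average_sub_average_sq_le {l h : ℝ} (hh : 0 < h)
    {V : SplitSpace N → ℝ} (hV : ContDiff ℝ 1 V) {t : ℝ} (ht : t ∈ Ioo (-h) h) :
    ‖(⨍ x in Metric.ball (0 : EuclideanSpace ℝ (Fin (N - 1))) l, V (WithLp.toLp 2 (x, t))) -
      ⨍ p in openCylinder N l h, V p‖ₑ ^ 2 ≤
      (volume (Metric.ball (0 : EuclideanSpace ℝ (Fin (N - 1))) l))⁻¹ * ENNReal.ofReal (2 * h) *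
        ∫⁻ p in openCylinder N l h, ‖fderiv ℝ V p‖ₑ ^ 2 := by
  set B := Metric.ball (0 : EuclideanSpace ℝ (Fin (N - 1))) l with hB
  set I := Ioo (-h) h with hI
  have hIv : volume I = ENNReal.ofReal (2 * h) := by
    rw [hI, Real.volume_Ioo]
    ring_nf
  have hI0 : volume I ≠ 0 := by
    rw [hIv]
    simpa using hh
  have : IsFiniteMeasure (volume.restrict B) := ⟨by simpa using measure_ball_lt_top⟩
  have : IsFiniteMeasure (volume.restrict I) := ⟨by simp [hI]⟩
  have : NeZero (volume.restrict I) := ⟨by simpa using hI0⟩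
  have hV0 : Continuous V := hV.continuous
  have hc1 : ∀ x, Continuous fun s => V (WithLp.toLp 2 (x, s)) := fun x =>
    hV0.comp (contDiff_toLp_right x (n := 0)).continuous
  have hc2 : ∀ s, Continuous fun x => V (WithLp.toLp 2 (x, s)) := fun s =>
    hV0.comp (contDiff_toLp_left s (n := 0)).continuous
  have hi1 : ∀ x, IntegrableOn (fun s => V (WithLp.toLp 2 (x, s))) I := fun x =>
    (((hc1 x).continuousOn).integrableOn_compact (isCompact_Icc (a := -h) (b := h))).mono_set
      Ioo_subset_Icc_self
  have hi2 : IntegrableOn (fun x => V (WithLp.toLp 2 (x, t))) B :=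
    ((hc2 t).continuousOn.integrableOn_compact (isCompact_closedBall _ l)).mono_set
      Metric.ball_subset_closedBall
  have hcyl : IntegrableOn (fun x => ⨍ s in I, V (WithLp.toLp 2 (x, s))) B := by
    simp_rw [setAverage_eq, smul_eq_mul]
    refine Integrable.const_mul ?_ _
    have hme : MeasurableEmbedding
      (fun p : EuclideanSpace ℝ (Fin (N - 1)) × ℝ => (WithLp.toLp 2 p : SplitSpace N)) :=
      (MeasurableEquiv.toLp 2 _).measurableEmbedding
    have hmp := WithLp.volume_preserving_toLp (EuclideanSpace ℝ (Fin (N - 1))) ℝ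
    have := (hmp.integrableOn_comp_preimage hme).2
      (integrableOn_openCylinder_of_continuous l h hV0)
    rw [preimage_toLp_openCylinder, Measure.volume_eq_prod, IntegrableOn,
      ← Measure.prod_restrict] at this
    exact this.integral_prod_left
  -- On each vertical segment, the value at height `t` is compared with the mean of that segment.
  -- Averaging over `x` afterwards gains the factor `1 / |B|`.
  have key : ∀ x, ‖V (WithLp.toLp 2 (x, t)) - ⨍ s in I, V (WithLp.toLp 2 (x, s))‖ₑ ^ 2 ≤
      volume I * ∫⁻ s in I, ‖fderiv ℝ V (WithLp.toLp 2 (x, s))‖ₑ ^ 2 := fun x => by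
    refine (enorm_sub_average_sq_le (hi1 x) _).trans ?_
    rw [Measure.restrict_apply_univ]
    set J := ∫⁻ s in I, ‖fderiv ℝ V (WithLp.toLp 2 (x, s))‖ₑ ^ 2
    have : ∀ s ∈ I, ‖V (WithLp.toLp 2 (x, t)) - V (WithLp.toLp 2 (x, s))‖ₑ ^ 2 ≤
        volume I * J := fun s hs => by
      refine (enorm_sub_sq_le_lintegral_deriv (γ := fun s => V (WithLp.toLp 2 (x, s)))
        (hV.comp (contDiff_toLp_right x)) (a := s) (b := t) (I := I) ?_).trans ?_
      · exact uIoc_subset_uIcc.trans (ordConnected_Ioo.uIcc_subset hs ht)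
      · refine mul_le_mul_right (lintegral_mono fun r => pow_le_pow_left' ?_ 2) _
        rw [← ofReal_norm, norm_deriv_eq_norm_fderiv, ofReal_norm]
        exact enorm_fderiv_comp_le hV ((contDiff_toLp_right x (n := 1)).differentiable one_ne_zero)
          (lipschitzWith_toLp_right x) r
    calc (volume I)⁻¹ * ∫⁻ s in I, ‖V (WithLp.toLp 2 (x, t)) - V (WithLp.toLp 2 (x, s))‖ₑ ^ 2
        ≤ (volume I)⁻¹ * ∫⁻ s in I, volume I * J := by
          gcongr 1
          exact setLIntegral_mono' measurableSet_Ioo this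
      _ = ((volume I)⁻¹ * volume I) * (volume I * J) := by
          rw [setLIntegral_const]
          ring
      _ = _ := by rw [ENNReal.inv_mul_cancel hI0 (by simp [hI]), one_mul]
  have hsub : (⨍ x in B, V (WithLp.toLp 2 (x, t))) - ⨍ p in openCylinder N l h, V p =
      ⨍ x in B, (V (WithLp.toLp 2 (x, t)) - ⨍ s in I, V (WithLp.toLp 2 (x, s))) := by
    rw [average_openCylinder l h hV0, setAverage_eq, setAverage_eq, setAverage_eq, ← smul_sub,
      integral_sub hi2 hcyl]
  rw [hsub]
  refine (enorm_average_sq_le (hi2.sub hcyl).1).trans ?_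
  rw [Measure.restrict_apply_univ, mul_assoc]
  gcongr 1
  refine (lintegral_mono key).trans_eq ?_
  rw [lintegral_const_mul' _ _ (by simp [hI]), hIv,
    lintegral_openCylinder' l h ((hV.continuous_fderiv one_ne_zero).measurable.enorm.pow_const 2)]

end Vertical

/-! ### The error produced by the cutoff -/

section Smooth

variable {N : ℕ}

/-- The deviation `V - m` splits into the deviation from the slice mean and that of the slice mean
from `m`. The first is paid for by Hardy's inequality on each slice, through `|∇η|² ≤ ε / (1 +
|x'|²)`. The second is bounded uniformly in the height, so only the volume of the support of `η`
counts. This is why `η` is compactly supported in all of `ℝ^N` rather than in the horizontal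
variables alone: the volume does not grow with `h`. -/
theorem lintegral_sub_average_mul_cutoff_le {C : ℝ≥0∞}
    (hC : ∀ l : ℝ, 0 < l → ∀ u : EuclideanSpace ℝ (Fin (N - 1)) → ℝ, ContDiff ℝ 1 u →
      ∫⁻ x in Metric.ball 0 (l / 2), ‖u x - ⨍ y in Metric.ball 0 l, u y‖ₑ ^ 2 *
        ENNReal.ofReal (1 / (1 + ‖x‖ ^ 2)) ≤
      C * ∫⁻ x in Metric.ball 0 l, ‖fderiv ℝ u x‖ₑ ^ 2)
    {R ε : ℝ} (hR : 0 < R) (hε : 0 < ε) {η : SplitSpace N → ℝ} (hη0 : ∀ x, 0 ≤ η x)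
    (hηR : ∀ x, R ≤ ‖x‖ → η x = 0) (hηd : ∀ x, ‖fderiv ℝ η x‖ ^ 2 ≤ ε / (1 + ‖x‖ ^ 2))
    {l h : ℝ} (hl : 2 * R ≤ l) (hh : 0 < h) {V : SplitSpace N → ℝ} (hV : ContDiff ℝ 1 V) :
    ∫⁻ p in openCylinder N l h,
      ‖V p - ⨍ q in openCylinder N l h, V q‖ₑ ^ 2 * ‖fderiv ℝ η p‖ₑ ^ 2 ≤
    ENNReal.ofReal ε * (2 * C + 2 * (volume (Metric.ball (0 : SplitSpace N) R) *
      ((volume (Metric.ball (0 : EuclideanSpace ℝ (Fin (N - 1))) l))⁻¹ *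
        ENNReal.ofReal (2 * h)))) *
      ∫⁻ p in openCylinder N l h, ‖fderiv ℝ V p‖ₑ ^ 2 := by
  have hl0 : 0 < l := by linarith
  set m := ⨍ q in openCylinder N l h, V q with hm
  set B := Metric.ball (0 : EuclideanSpace ℝ (Fin (N - 1))) l with hB
  set I := Ioo (-h) h with hI
  set E := ∫⁻ p in openCylinder N l h, ‖fderiv ℝ V p‖ₑ ^ 2 with hE
  set f : ℝ → ℝ := fun t => ⨍ x in B, V (WithLp.toLp 2 (x, t)) with hf
  set D := (volume B)⁻¹ * ENNReal.ofReal (2 * h) * E with hD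
  set S := Metric.ball (0 : SplitSpace N) R with hS
  have hSm : MeasurableSet S := measurableSet_ball
  set w : EuclideanSpace ℝ (Fin (N - 1)) → ℝ≥0∞ :=
    (Metric.ball 0 (l / 2)).indicator fun x => ENNReal.ofReal (1 / (1 + ‖x‖ ^ 2)) with hw
  have hmV : Measurable V := hV.continuous.measurable
  -- The zeros of `η ≥ 0` are minima, so the gradient vanishes also on the bounding sphere.
  have hηz : ∀ p, p ∉ S → fderiv ℝ η p = 0 := fun p hp => by
    have hp0 : η p = 0 := hηR p (by simpa [hS] using hp)
    exact IsLocalMin.fderiv_eq_zero (Eventually.of_forall fun q => by rw [hp0]; exact hη0 q)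
  have hfst : ∀ (x : EuclideanSpace ℝ (Fin (N - 1))) (t : ℝ),
      ‖x‖ ≤ ‖(WithLp.toLp 2 (x, t) : SplitSpace N)‖ := fun x t => by
    rw [WithLp.prod_norm_eq_of_L2]
    exact Real.le_sqrt_of_sq_le (by simpa using sq_nonneg t)
  have hd1 : ∀ p, ‖fderiv ℝ η p‖ₑ ^ 2 ≤ ENNReal.ofReal ε * ENNReal.ofReal (1 / (1 + ‖p‖ ^ 2)) :=
    fun p => by
      rw [← ofReal_norm, ← ENNReal.ofReal_pow (norm_nonneg _), ← ENNReal.ofReal_mul hε.le,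
        mul_one_div]
      exact ENNReal.ofReal_le_ofReal (hηd p)
  -- The weight is enlarged to one depending on `x'` only. Its restriction to the half ball is
  -- harmless because `R ≤ l / 2`.
  have hd2 : ∀ x t, ‖fderiv ℝ η (WithLp.toLp 2 (x, t))‖ₑ ^ 2 ≤ ENNReal.ofReal ε * w x :=
    fun x t => by
      by_cases hp : (WithLp.toLp 2 (x, t) : SplitSpace N) ∈ S
      · have hx : x ∈ Metric.ball (0 : EuclideanSpace ℝ (Fin (N - 1))) (l / 2) := by
          rw [hS, mem_ball_zero_iff] at hp
          rw [mem_ball_zero_iff]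
          linarith [hfst x t]
        rw [hw, indicator_of_mem hx]
        refine (hd1 _).trans ?_
        gcongr
        exact hfst x t
      · rw [← ofReal_norm, hηz _ hp]
        simp
  have hd3 : ∀ p, ‖fderiv ℝ η p‖ₑ ^ 2 ≤ ENNReal.ofReal ε * S.indicator 1 p := fun p => by
    by_cases hp : p ∈ S
    · rw [indicator_of_mem hp]
      refine (hd1 _).trans ?_
      gcongr
      rw [Pi.one_apply, ENNReal.ofReal_le_one, div_le_one (by positivity)]
      nlinarith [sq_nonneg ‖p‖]
    · rw [← ofReal_norm, hηz _ hp]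
      simp
  have hpt : ∀ t ∈ I, ∀ x, ‖V (WithLp.toLp 2 (x, t)) - m‖ₑ ^ 2 *
      ‖fderiv ℝ η (WithLp.toLp 2 (x, t))‖ₑ ^ 2 ≤
      2 * ENNReal.ofReal ε * (‖V (WithLp.toLp 2 (x, t)) - f t‖ₑ ^ 2 * w x) +
      2 * ENNReal.ofReal ε * D * S.indicator 1 (WithLp.toLp 2 (x, t) : SplitSpace N) := by
    intro t ht x
    set p : SplitSpace N := WithLp.toLp 2 (x, t)
    have h1 : ‖V p - m‖ₑ ^ 2 ≤ 2 * ‖V p - f t‖ₑ ^ 2 + 2 * D := by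
      have : V p - m = (V p - f t) + (f t - m) := by ring
      rw [this]
      refine (pow_le_pow_left' (enorm_add_le _ _) 2).trans
        ((ENNReal.add_sq_le_two_mul _ _).trans ?_)
      gcongr
      exact enorm_slice_average_sub_average_sq_le hh hV ht
    calc ‖V p - m‖ₑ ^ 2 * ‖fderiv ℝ η p‖ₑ ^ 2
        ≤ (2 * ‖V p - f t‖ₑ ^ 2 + 2 * D) * ‖fderiv ℝ η p‖ₑ ^ 2 := mul_le_mul_left h1 _
      _ = 2 * ‖V p - f t‖ₑ ^ 2 * ‖fderiv ℝ η p‖ₑ ^ 2 + 2 * D * ‖fderiv ℝ η p‖ₑ ^ 2 := by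
          rw [add_mul]
      _ ≤ 2 * ‖V p - f t‖ₑ ^ 2 * (ENNReal.ofReal ε * w x) +
          2 * D * (ENNReal.ofReal ε * S.indicator 1 p) :=
          add_le_add (mul_le_mul_right (hd2 x t) _) (mul_le_mul_right (hd3 p) _)
      _ = _ := by ring
  have hslice : ∀ t, ∫⁻ x in B, ‖V (WithLp.toLp 2 (x, t)) - f t‖ₑ ^ 2 * w x ≤
      C * ∫⁻ x in B, ‖fderiv ℝ V (WithLp.toLp 2 (x, t))‖ₑ ^ 2 := fun t => by
    calc ∫⁻ x in B, ‖V (WithLp.toLp 2 (x, t)) - f t‖ₑ ^ 2 * w x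
        ≤ ∫⁻ x, ‖V (WithLp.toLp 2 (x, t)) - f t‖ₑ ^ 2 * w x := setLIntegral_le_lintegral _ _
      _ = ∫⁻ x in Metric.ball 0 (l / 2), ‖V (WithLp.toLp 2 (x, t)) - f t‖ₑ ^ 2 *
            ENNReal.ofReal (1 / (1 + ‖x‖ ^ 2)) := by
          rw [← lintegral_indicator measurableSet_ball]
          refine lintegral_congr fun x => ?_
          by_cases hx : x ∈ Metric.ball (0 : EuclideanSpace ℝ (Fin (N - 1))) (l / 2) <;>
            simp only [hw, hx, indicator_of_mem, indicator_of_notMem, not_false_eq_true, mul_zero]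
      _ ≤ C * ∫⁻ x in B, ‖fderiv ℝ (fun x => V (WithLp.toLp 2 (x, t))) x‖ₑ ^ 2 :=
          hC l hl0 (fun x => V (WithLp.toLp 2 (x, t))) (hV.comp (contDiff_toLp_left t))
      _ ≤ _ := by
          refine mul_le_mul_right (lintegral_mono fun x => pow_le_pow_left' ?_ 2) _
          exact enorm_fderiv_comp_le hV ((contDiff_toLp_left t (n := 1)).differentiable one_ne_zero)
            (lipschitzWith_toLp_left t) x
  have hmS : Measurable fun p : SplitSpace N =>
      2 * ENNReal.ofReal ε * D * S.indicator (1 : SplitSpace N → ℝ≥0∞) p :=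
    (measurable_one.indicator hSm).const_mul _
  have hmS' : ∀ t, Measurable fun x : EuclideanSpace ℝ (Fin (N - 1)) =>
      2 * ENNReal.ofReal ε * D *
        S.indicator (1 : SplitSpace N → ℝ≥0∞) (WithLp.toLp 2 (x, t)) := fun t =>
    hmS.comp (measurable_toLp_prod.comp (by fun_prop : Measurable fun x => (x, t)))
  have hmS2 : Measurable fun t => ∫⁻ x in B, 2 * ENNReal.ofReal ε * D *
      S.indicator (1 : SplitSpace N → ℝ≥0∞) (WithLp.toLp 2 (x, t)) :=
    Measurable.lintegral_prod_left' (hmS.comp measurable_toLp_prod)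
  have hmd : Measurable fun p => ‖fderiv ℝ V p‖ₑ ^ 2 :=
    (hV.continuous_fderiv one_ne_zero).measurable.enorm.pow_const 2
  have hmL : Measurable fun p => ‖V p - m‖ₑ ^ 2 * ‖fderiv ℝ η p‖ₑ ^ 2 :=
    ((hmV.sub_const m).enorm.pow_const 2).mul ((measurable_fderiv ℝ η).enorm.pow_const 2)
  calc ∫⁻ p in openCylinder N l h, ‖V p - m‖ₑ ^ 2 * ‖fderiv ℝ η p‖ₑ ^ 2
      = ∫⁻ t in I, ∫⁻ x in B, ‖V (WithLp.toLp 2 (x, t)) - m‖ₑ ^ 2 *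
          ‖fderiv ℝ η (WithLp.toLp 2 (x, t))‖ₑ ^ 2 := lintegral_openCylinder l h hmL
    _ ≤ ∫⁻ t in I, ∫⁻ x in B,
          (2 * ENNReal.ofReal ε * (‖V (WithLp.toLp 2 (x, t)) - f t‖ₑ ^ 2 * w x) +
          2 * ENNReal.ofReal ε * D * S.indicator 1 (WithLp.toLp 2 (x, t) : SplitSpace N)) :=
        setLIntegral_mono' measurableSet_Ioo fun t ht => lintegral_mono fun x => hpt t ht x
    _ = ∫⁻ t in I, ((2 * ENNReal.ofReal ε *
            ∫⁻ x in B, (‖V (WithLp.toLp 2 (x, t)) - f t‖ₑ ^ 2 * w x)) +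
          ∫⁻ x in B, 2 * ENNReal.ofReal ε * D *
            S.indicator 1 (WithLp.toLp 2 (x, t) : SplitSpace N)) := by
        refine lintegral_congr fun t => ?_
        rw [lintegral_add_right _ (hmS' t), lintegral_const_mul' _ _ (by finiteness)]
    _ ≤ ∫⁻ t in I, ((2 * ENNReal.ofReal ε *
            (C * ∫⁻ x in B, ‖fderiv ℝ V (WithLp.toLp 2 (x, t))‖ₑ ^ 2)) +
          ∫⁻ x in B, 2 * ENNReal.ofReal ε * D *
            S.indicator 1 (WithLp.toLp 2 (x, t) : SplitSpace N)) :=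
        lintegral_mono fun t => add_le_add_left (mul_le_mul_right (hslice t) _) _
    _ = 2 * ENNReal.ofReal ε * C * E + ∫⁻ p in openCylinder N l h,
          2 * ENNReal.ofReal ε * D * S.indicator 1 p := by
        rw [lintegral_add_right _ hmS2, lintegral_openCylinder l h hmS, hE,
          lintegral_openCylinder l h hmd]
        simp_rw [← mul_assoc]
        rw [lintegral_const_mul]
        exact Measurable.lintegral_prod_left' (hmd.comp measurable_toLp_prod)
    _ ≤ 2 * ENNReal.ofReal ε * C * E + 2 * ENNReal.ofReal ε * D * volume S := by
        gcongr
        refine (setLIntegral_le_lintegral _ _).trans_eq ?_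
        rw [lintegral_const_mul _ (measurable_one.indicator hSm), lintegral_indicator_one hSm]
    _ = _ := by
        rw [hD]
        ring

end Smooth

/-! ### The competitor for the capacity -/

section Capacity

theorem norm_gradient {E : Type*} [NormedAddCommGroup E] [InnerProductSpace ℝ E]
    [CompleteSpace E] (f : E → ℝ) (x : E) : ‖gradient f x‖ = ‖fderiv ℝ f x‖ := by
  rw [gradient, LinearIsometryEquiv.norm_map]

theorem enorm_gradient {E : Type*} [NormedAddCommGroup E] [InnerProductSpace ℝ E]
    [CompleteSpace E] (f : E → ℝ) (x : E) : ‖gradient f x‖ₑ = ‖fderiv ℝ f x‖ₑ := by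
  rw [← ofReal_norm, norm_gradient, ofReal_norm]

variable {N : ℕ}

theorem isOpen_strip (h : ℝ) : IsOpen (strip N h) :=
  isOpen_Ioo.preimage (WithLp.continuous_snd 2 _ _)

theorem norm_fst_le_norm (p : SplitSpace N) : ‖p.fst‖ ≤ ‖p‖ := by
  rw [WithLp.prod_norm_eq_of_L2]
  exact Real.le_sqrt_of_sq_le (by nlinarith [sq_nonneg ‖p.snd‖])

theorem norm_eq_norm_fst_of_mem_flatSet {K' : Set (EuclideanSpace ℝ (Fin (N - 1)))}
    {p : SplitSpace N} (hp : p ∈ flatSet K') : ‖p‖ = ‖p.fst‖ := by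
  rw [WithLp.prod_norm_eq_of_L2, hp.2]
  simp

theorem flatSet_subset_strip {h : ℝ} (hh : 0 < h) (K' : Set (EuclideanSpace ℝ (Fin (N - 1)))) :
    flatSet K' ⊆ strip N h := fun p hp => by
  change p.snd ∈ Ioo (-h) h
  rw [hp.2]
  exact ⟨by linarith, hh⟩

theorem stripCap_le_lintegral {h : ℝ} (hh : 0 < h) {K' : Set (EuclideanSpace ℝ (Fin (N - 1)))}
    {w : SplitSpace N → ℝ} (hw : ContDiff ℝ ∞ w) {R : ℝ} (hR : ∀ x, R ≤ ‖x‖ → w x = 0)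
    {O : Set (SplitSpace N)} (hO : IsOpen O) (hKO : flatSet K' ⊆ O) (h1 : ∀ x ∈ O, w x = 1) :
    stripCap h K' ≤ ∫⁻ x in strip N h, ‖fderiv ℝ w x‖ₑ ^ 2 := by
  have htest : IsStripTestFunction N h w := by
    refine ⟨hw.contDiffOn, (isCompact_closedBall (0 : SplitSpace N) R).of_isClosed_subset
      isClosed_closure (closure_minimal (fun x hx => ?_) Metric.isClosed_closedBall)⟩
    rw [mem_closedBall_zero_iff]
    by_contra hlt
    exact hx.2 (hR x (not_le.1 hlt).le)
  have hint : flatSet K' ⊆ interior {x | x ∈ closure (strip N h) ∧ w x = 1} := fun p hp =>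
    mem_interior.2 ⟨O ∩ strip N h, fun x hx => ⟨subset_closure hx.2, h1 x hx.1⟩,
      hO.inter (isOpen_strip h), hKO hp, flatSet_subset_strip hh K' hp⟩
  refine (iInf₂_le_of_le w htest (iInf_le _ hint)).trans_eq ?_
  simp_rw [enorm_gradient]

/-- Young's inequality with parameter `s`. The coefficient of the main term must be close to `1`,
since `θ` may be close to `1`; the large factor `1 + 1 / s` falls on the error, which the cutoff
makes small. -/
theorem enorm_fderiv_mul_sub_sq_le {E : Type*} [NormedAddCommGroup E] [NormedSpace ℝ E]
    {η V : E → ℝ} {x : E} (hη : DifferentiableAt ℝ η x) (hV : DifferentiableAt ℝ V x)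
    (hη01 : η x ∈ Icc (0 : ℝ) 1) (m : ℝ) {s : ℝ} (hs : 0 < s) :
    ‖fderiv ℝ (fun y => η y * (V y - m)) x‖ₑ ^ 2 ≤
      ENNReal.ofReal (1 + s) * ‖fderiv ℝ V x‖ₑ ^ 2 +
      ENNReal.ofReal (1 + 1 / s) * (‖V x - m‖ₑ ^ 2 * ‖fderiv ℝ η x‖ₑ ^ 2) := by
  have h1 : ‖fderiv ℝ (fun y => η y * (V y - m)) x‖ ≤
      ‖fderiv ℝ V x‖ + ‖V x - m‖ * ‖fderiv ℝ η x‖ := by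
    rw [fderiv_fun_mul hη (hV.sub_const m), fderiv_sub_const]
    refine (norm_add_le _ _).trans ?_
    rw [norm_smul, norm_smul, Real.norm_of_nonneg hη01.1]
    gcongr
    exact mul_le_of_le_one_left (norm_nonneg _) hη01.2
  have h2 : ‖fderiv ℝ (fun y => η y * (V y - m)) x‖ ^ 2 ≤
      (1 + s) * ‖fderiv ℝ V x‖ ^ 2 + (1 + 1 / s) * (‖V x - m‖ ^ 2 * ‖fderiv ℝ η x‖ ^ 2) := by
    refine (pow_le_pow_left₀ (norm_nonneg _) h1 2).trans ?_
    rw [← mul_pow]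
    set a := ‖fderiv ℝ V x‖
    set b := ‖V x - m‖ * ‖fderiv ℝ η x‖
    have h3 : (1 + s) * a ^ 2 + (1 + 1 / s) * b ^ 2 - (a + b) ^ 2 = (s * a - b) ^ 2 / s := by
      field_simp
      ring
    have h4 : 0 ≤ (s * a - b) ^ 2 / s := by positivity
    linarith
  simp only [← ofReal_norm, ← ENNReal.ofReal_pow (norm_nonneg _)]
  rw [← ENNReal.ofReal_mul (by positivity), ← ENNReal.ofReal_mul (by positivity),
    ← ENNReal.ofReal_mul (by positivity), ← ENNReal.ofReal_add (by positivity) (by positivity)]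
  exact ENNReal.ofReal_le_ofReal h2

/-- The main inequality, for smooth functions. -/
theorem exists_mul_stripCap_le_of_contDiff (hN : 3 < N)
    {K' : Set (EuclideanSpace ℝ (Fin (N - 1)))} (hK' : Bornology.IsBounded K') {δ : ℝ}
    (hδ : 0 < δ) :
    ∃ L τ : ℝ, 0 < L ∧ 0 < τ ∧ ∀ l h : ℝ, L ≤ l → 0 < h → h / l ^ (N - 1) ≤ τ →
      ∀ V : SplitSpace N → ℝ, ContDiff ℝ ∞ V →
      ∀ O : Set (SplitSpace N), IsOpen O → flatSet K' ⊆ O → (∀ x ∈ O, V x = 1) →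
        ENNReal.ofReal ((1 - ⨍ x in openCylinder N l h, V x) ^ 2) * stripCap h K' ≤
          ENNReal.ofReal (1 + δ) * ∫⁻ x in openCylinder N l h, ‖fderiv ℝ V x‖ₑ ^ 2 := by
  obtain ⟨C, hCt, hC⟩ := exists_lintegral_sub_average_sq_mul_le (d := N - 1) (by omega)
  obtain ⟨r, hr⟩ := hK'.subset_ball (0 : EuclideanSpace ℝ (Fin (N - 1)))
  -- Half of `δ` is spent on Young's inequality, the other half on the cutoff error.
  set s : ℝ := δ / 2 with hs
  have hs0 : 0 < s := by positivity
  set A : ℝ := 1 + 1 / s with hA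
  have hA0 : 0 < A := by positivity
  set c : ℝ := C.toReal with hc
  have hc0 : 0 ≤ c := ENNReal.toReal_nonneg
  -- Chosen so that `A ε (2 c + 1) = δ / 2`; the `1` is reserved for the oscillation of the slice
  -- means.
  set ε : ℝ := δ / (2 * A * (2 * c + 1)) with hεdef
  have hε : 0 < ε := by positivity
  obtain ⟨R, η, hR, hηc, hη01, hη1, hηR, hηd⟩ :=
    exists_log_cutoff (E := SplitSpace N) (r + 1) hε
  set σ : ℝ := (volume (Metric.ball (0 : SplitSpace N) R)).toReal with hσ
  have hσ0 : 0 < σ := ENNReal.toReal_pos (Metric.measure_ball_pos _ _ hR).ne'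
    measure_ball_lt_top.ne
  set κ : ℝ := (volume (Metric.ball (0 : EuclideanSpace ℝ (Fin (N - 1))) 1)).toReal with hκ
  have hκ0 : 0 < κ := ENNReal.toReal_pos (Metric.measure_ball_pos _ _ one_pos).ne'
    measure_ball_lt_top.ne
  -- `l ≥ 2 R` places the support of `η` over the half ball. The bound `κ / (4 σ)` is what makes the
  -- slice-mean term `2 σ (2 h) / (κ l^(N-1))` at most `1`.
  refine ⟨2 * R, κ / (4 * σ), by positivity, by positivity,
    fun l h hl hh hτ V hV O hO hKO hVO => ?_⟩
  have hl0 : 0 < l := by linarith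
  set m := ⨍ x in openCylinder N l h, V x with hm
  set E := ∫⁻ x in openCylinder N l h, ‖fderiv ℝ V x‖ₑ ^ 2 with hE
  rcases eq_or_ne (1 - m) 0 with hm1 | hm1
  · simp [hm1]
  have hV1 : ContDiff ℝ 1 V := hV.of_le (by simp)
  have hVd : Differentiable ℝ V := hV1.differentiable one_ne_zero
  have hηdiff : Differentiable ℝ η := hηc.differentiable (by simp)
  set z : SplitSpace N → ℝ := fun x => η x * (V x - m) with hz
  have hzc : ContDiff ℝ ∞ z := hηc.mul (hV.sub contDiff_const)
  have hηR' : ∀ x, R ≤ ‖x‖ → fderiv ℝ η x = 0 := fun x hx =>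
    IsLocalMin.fderiv_eq_zero (Eventually.of_forall fun q => by
      rw [hηR x hx]
      exact (hη01 q).1)
  -- The competitor is `(1 - m)⁻¹ η (V - m)`. It equals `1` where `V = 1` and `η = 1`; taking `η =
  -- 1` up to radius `r + 1` makes this a neighbourhood of `K' × {0}`.
  have hcap : ENNReal.ofReal ((1 - m) ^ 2) * stripCap h K' ≤
      ∫⁻ x in strip N h, ‖fderiv ℝ z x‖ₑ ^ 2 := by
    have h1 := stripCap_le_lintegral (K' := K') hh (w := fun x => (1 - m)⁻¹ * z x)
      (contDiff_const.mul hzc) (R := R) (fun x hx => by simp [hz, hηR x hx])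
      (O := O ∩ Metric.ball 0 (r + 1)) (hO.inter Metric.isOpen_ball) (fun p hp => ⟨hKO hp, ?_⟩)
      (fun x hx => ?_)
    · refine (mul_le_mul_right h1 _).trans_eq ?_
      rw [← lintegral_const_mul' _ _ (by finiteness)]
      refine lintegral_congr fun x => ?_
      rw [fderiv_const_mul (hzc.differentiable (by simp) x), enorm_smul, mul_pow, ← mul_assoc,
        ← ofReal_norm (1 - m)⁻¹, ← ENNReal.ofReal_pow (norm_nonneg _),
        ← ENNReal.ofReal_mul (by positivity), norm_inv, Real.norm_eq_abs, inv_pow, sq_abs,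
        mul_inv_cancel₀ (pow_ne_zero 2 hm1), ENNReal.ofReal_one, one_mul]
    · rw [mem_ball_zero_iff, norm_eq_norm_fst_of_mem_flatSet hp]
      have := mem_ball_zero_iff.1 (hr hp.1)
      linarith
    · have h2 := mem_ball_zero_iff.1 hx.2
      simp only [hz, hη1 x h2.le, hVO x hx.1, one_mul]
      exact inv_mul_cancel₀ hm1
  refine hcap.trans ?_
  have hCm := (isOpen_openCylinder (N := N) l h).measurableSet
  -- Beyond radius `R` both `η` and its gradient vanish, and the part of the strip within radius `R`
  -- lies in the cylinder.
  have hloc : ∫⁻ x in strip N h, ‖fderiv ℝ z x‖ₑ ^ 2 ≤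
      ∫⁻ x in openCylinder N l h, ‖fderiv ℝ z x‖ₑ ^ 2 := by
    rw [← lintegral_indicator hCm, ← lintegral_indicator (isOpen_strip h).measurableSet]
    refine lintegral_mono fun x => ?_
    by_cases hx : x ∈ strip N h
    · rcases lt_or_ge ‖x‖ R with hxR | hxR
      · have hxC : x ∈ openCylinder N l h := ⟨by
          rw [mem_ball_zero_iff]
          linarith [norm_fst_le_norm x], hx⟩
        rw [indicator_of_mem hx, indicator_of_mem hxC]
      · have : fderiv ℝ z x = 0 := by
          rw [hz, fderiv_fun_mul (hηdiff x) ((hVd x).sub_const m), hηR x hxR, hηR' x hxR]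
          simp
        rw [indicator_of_mem hx, ← ofReal_norm, this]
        simp
    · rw [indicator_of_notMem hx]
      exact zero_le
  refine hloc.trans ?_
  have hcut := lintegral_sub_average_mul_cutoff_le hC hR hε (fun x => (hη01 x).1) hηR hηd hl hh hV1
  set T := ∫⁻ p in openCylinder N l h, ‖V p - m‖ₑ ^ 2 * ‖fderiv ℝ η p‖ₑ ^ 2 with hT
  have hconst : ENNReal.ofReal A * (ENNReal.ofReal ε * (2 * C +
      2 * (volume (Metric.ball (0 : SplitSpace N) R) *
      ((volume (Metric.ball (0 : EuclideanSpace ℝ (Fin (N - 1))) l))⁻¹ *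
        ENNReal.ofReal (2 * h))))) ≤ ENNReal.ofReal (δ / 2) := by
    have e1 : C = ENNReal.ofReal c := (ENNReal.ofReal_toReal hCt).symm
    have e2 : volume (Metric.ball (0 : SplitSpace N) R) = ENNReal.ofReal σ :=
      (ENNReal.ofReal_toReal measure_ball_lt_top.ne).symm
    have e3 : volume (Metric.ball (0 : EuclideanSpace ℝ (Fin (N - 1))) l) =
        ENNReal.ofReal (l ^ (N - 1) * κ) := by
      rw [Measure.addHaar_ball_of_pos _ _ hl0, ENNReal.ofReal_mul (by positivity), hκ,
        ENNReal.ofReal_toReal measure_ball_lt_top.ne, finrank_euclideanSpace_fin]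
    have e4 : (2 : ℝ≥0∞) = ENNReal.ofReal 2 := by simp
    rw [e1, e2, e3, e4, ← ENNReal.ofReal_inv_of_pos (by positivity),
      ← ENNReal.ofReal_mul (by positivity), ← ENNReal.ofReal_mul (by positivity),
      ← ENNReal.ofReal_mul (by positivity), ← ENNReal.ofReal_mul (by positivity),
      ← ENNReal.ofReal_add (by positivity) (by positivity), ← ENNReal.ofReal_mul (by positivity),
      ← ENNReal.ofReal_mul (by positivity)]
    refine ENNReal.ofReal_le_ofReal ?_
    have h1 : 2 * (σ * ((l ^ (N - 1) * κ)⁻¹ * (2 * h))) ≤ 1 := by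
      have : 2 * (σ * ((l ^ (N - 1) * κ)⁻¹ * (2 * h))) = (4 * σ / κ) * (h / l ^ (N - 1)) := by
        field_simp
        ring
      rw [this]
      calc (4 * σ / κ) * (h / l ^ (N - 1)) ≤ (4 * σ / κ) * (κ / (4 * σ)) := by gcongr
        _ = 1 := by field_simp
    calc A * (ε * (2 * c + 2 * (σ * ((l ^ (N - 1) * κ)⁻¹ * (2 * h))))) ≤
        A * (ε * (2 * c + 1)) := by gcongr
      _ = δ / 2 := by
        rw [hεdef]
        field_simp
  calc ∫⁻ x in openCylinder N l h, ‖fderiv ℝ z x‖ₑ ^ 2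
      ≤ ∫⁻ x in openCylinder N l h, (ENNReal.ofReal (1 + s) * ‖fderiv ℝ V x‖ₑ ^ 2 +
          ENNReal.ofReal A * (‖V x - m‖ₑ ^ 2 * ‖fderiv ℝ η x‖ₑ ^ 2)) :=
        lintegral_mono fun x => enorm_fderiv_mul_sub_sq_le (hηdiff x) (hVd x) (hη01 x) m hs0
    _ = ENNReal.ofReal (1 + s) * E + ENNReal.ofReal A * T := by
        rw [lintegral_add_left, lintegral_const_mul' _ _ (by finiteness),
          lintegral_const_mul' _ _ (by finiteness)]
        exact ((hV1.continuous_fderiv one_ne_zero).measurable.enorm.pow_const 2).const_mul _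
    _ ≤ ENNReal.ofReal (1 + s) * E + ENNReal.ofReal (δ / 2) * E := by
        gcongr 1
        refine (mul_le_mul_right hcut _).trans ?_
        rw [← mul_assoc]
        exact mul_le_mul_left hconst _
    _ = ENNReal.ofReal (1 + δ) * E := by
        rw [← add_mul, ← ENNReal.ofReal_add (by positivity) (by positivity), hs]
        ring_nf

end Capacity

/-! ### Dependence of the capacity on the height of the strip -/

section Scaling

variable {N : ℕ}

/-- The map `(x', t) ↦ (x', a t)`. -/
noncomputable def verticalScaling (N : ℕ) (a : ℝ) (ha : a ≠ 0) : SplitSpace N ≃L[ℝ] SplitSpace N :=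
  ((WithLp.prodContinuousLinearEquiv 2 ℝ (EuclideanSpace ℝ (Fin (N - 1))) ℝ).trans
    ((ContinuousLinearEquiv.refl ℝ _).prodCongr
      (ContinuousLinearEquiv.unitsEquivAut ℝ (Units.mk0 a ha)))).trans
    (WithLp.prodContinuousLinearEquiv 2 ℝ (EuclideanSpace ℝ (Fin (N - 1))) ℝ).symm

theorem verticalScaling_apply {a : ℝ} (ha : a ≠ 0) (p : SplitSpace N) :
    verticalScaling N a ha p = WithLp.toLp 2 (p.fst, a * p.snd) := by
  simp [verticalScaling, mul_comm]

theorem norm_verticalScaling_le {a : ℝ} (ha : 0 < a) (ha1 : a ≤ 1) :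
    ‖(verticalScaling N a ha.ne' : SplitSpace N →L[ℝ] SplitSpace N)‖ ≤ 1 := by
  refine ContinuousLinearMap.opNorm_le_bound _ zero_le_one fun p => ?_
  rw [one_mul, ContinuousLinearEquiv.coe_coe, verticalScaling_apply, WithLp.prod_norm_eq_of_L2,
    WithLp.prod_norm_eq_of_L2]
  refine Real.sqrt_le_sqrt ?_
  change ‖p.fst‖ ^ 2 + ‖a * p.snd‖ ^ 2 ≤ _
  gcongr
  rw [norm_mul, Real.norm_of_nonneg ha.le]
  exact mul_le_of_le_one_left (norm_nonneg _) ha1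

theorem lintegral_strip_comp_verticalScaling {h a : ℝ} (ha : 0 < a) {F : SplitSpace N → ℝ≥0∞}
    (hF : Measurable F) :
    ∫⁻ x in strip N h, F (verticalScaling N a ha.ne' x) =
      ENNReal.ofReal a⁻¹ * ∫⁻ x in strip N (a * h), F x := by
  have key : ∀ (k : ℝ) (G : SplitSpace N → ℝ≥0∞), Measurable G → ∫⁻ x in strip N k, G x =
      ∫⁻ x : EuclideanSpace ℝ (Fin (N - 1)), ∫⁻ t in Ioo (-k) k, G (WithLp.toLp 2 (x, t)) := by
    intro k G hG
    have hpre : WithLp.toLp 2 ⁻¹' strip N k =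
        (univ : Set (EuclideanSpace ℝ (Fin (N - 1)))) ×ˢ Ioo (-k) k := by
      ext p
      simp [strip]
    rw [← (WithLp.volume_preserving_toLp _ _).setLIntegral_comp_preimage
      (isOpen_strip k).measurableSet hG, hpre, Measure.volume_eq_prod, ← Measure.prod_restrict,
      lintegral_prod, Measure.restrict_univ]
    exact (hG.comp measurable_toLp_prod).aemeasurable
  rw [key h (fun x => F (verticalScaling N a ha.ne' x))
    (hF.comp (verticalScaling N a ha.ne').continuous.measurable), key _ _ hF,
    ← lintegral_const_mul']
  · refine lintegral_congr fun x => ?_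
    simp_rw [verticalScaling_apply]
    rw [← lintegral_indicator measurableSet_Ioo, ← lintegral_indicator measurableSet_Ioo]
    have h1 := lintegral_comp_smul_left (volume : Measure ℝ)
      ((Ioo (-(a * h)) (a * h)).indicator fun t => F (WithLp.toLp 2 (x, t))) ha.ne'
    rw [Module.finrank_self, pow_one, abs_of_pos (inv_pos.2 ha)] at h1
    rw [← h1]
    refine lintegral_congr fun t => ?_
    have : a • t ∈ Ioo (-(a * h)) (a * h) ↔ t ∈ Ioo (-h) h := by
      simp only [mem_Ioo, smul_eq_mul, ← mul_neg]
      rw [mul_lt_mul_iff_right₀ ha, mul_lt_mul_iff_right₀ ha]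
    by_cases ht : t ∈ Ioo (-h) h
    · rw [indicator_of_mem ht, indicator_of_mem (this.2 ht), smul_eq_mul]
      rfl
    · rw [indicator_of_notMem ht, indicator_of_notMem (fun h => ht (this.1 h))]
  · finiteness

/-- A competitor for height `a h` is composed with the contraction `(x', t) ↦ (x', a t)`, which
fixes `K' × {0}`. Since `a ≤ 1` the gradient does not grow, and the change of variables costs `a⁻¹`.
-/
theorem stripCap_le_mul_stripCap {h a : ℝ} (ha : 0 < a) (ha1 : a ≤ 1)
    (K' : Set (EuclideanSpace ℝ (Fin (N - 1)))) :
    stripCap h K' ≤ ENNReal.ofReal a⁻¹ * stripCap (a * h) K' := by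
  set T := verticalScaling N a ha.ne' with hT
  have hstrip : T ⁻¹' strip N (a * h) = strip N h := by
    ext p
    rw [mem_preimage, hT, verticalScaling_apply]
    change -(a * h) < a * p.snd ∧ a * p.snd < a * h ↔ -h < p.snd ∧ p.snd < h
    rw [← mul_neg, mul_lt_mul_iff_right₀ ha, mul_lt_mul_iff_right₀ ha]
  have hcl : T ⁻¹' closure (strip N (a * h)) = closure (strip N h) := by
    rw [← hstrip]
    exact T.toHomeomorph.preimage_closure _
  conv_rhs => unfold stripCap
  simp_rw [ENNReal.mul_iInf_of_ne (ENNReal.ofReal_pos.2 (inv_pos.2 ha)).ne' ENNReal.ofReal_ne_top]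
  refine le_iInf fun w => le_iInf fun hw => le_iInf fun hKw => ?_
  have htest : IsStripTestFunction N h (w ∘ T) := by
    refine ⟨?_, ?_⟩
    · refine hw.1.comp T.contDiff.contDiffOn ?_
      rw [← hcl]
      exact fun x hx => hx
    · have : {x | x ∈ closure (strip N h) ∧ (w ∘ T) x ≠ 0} =
          T ⁻¹' {x | x ∈ closure (strip N (a * h)) ∧ w x ≠ 0} := by
        ext x
        rw [← hcl]
        rfl
      rw [this, show T ⁻¹' {x | x ∈ closure (strip N (a * h)) ∧ w x ≠ 0} = T.toHomeomorph ⁻¹' _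
        from rfl, ← T.toHomeomorph.preimage_closure]
      exact T.toHomeomorph.isCompact_preimage.2 hw.2
  have hint : flatSet K' ⊆ interior {x | x ∈ closure (strip N h) ∧ (w ∘ T) x = 1} := by
    have : {x | x ∈ closure (strip N h) ∧ (w ∘ T) x = 1} =
        T ⁻¹' {x | x ∈ closure (strip N (a * h)) ∧ w x = 1} := by
      ext x
      rw [← hcl]
      rfl
    rw [this, show T ⁻¹' {x | x ∈ closure (strip N (a * h)) ∧ w x = 1} = T.toHomeomorph ⁻¹' _
      from rfl, ← T.toHomeomorph.preimage_interior]
    intro p hp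
    have : T p = p := by
      rw [hT, verticalScaling_apply, hp.2, mul_zero, ← hp.2]
      rfl
    rw [mem_preimage, show T.toHomeomorph p = p from this]
    exact hKw hp
  refine (iInf₂_le_of_le (w ∘ T) htest (iInf_le _ hint)).trans ?_
  rw [← lintegral_strip_comp_verticalScaling ha]
  · refine lintegral_mono fun x => pow_le_pow_left' ?_ 2
    rw [enorm_gradient, enorm_gradient, ← ofReal_norm, ← ofReal_norm,
      ContinuousLinearEquiv.comp_right_fderiv]
    refine ENNReal.ofReal_le_ofReal ((ContinuousLinearMap.opNorm_comp_le _ _).trans ?_)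
    exact mul_le_of_le_one_right (norm_nonneg _) (norm_verticalScaling_le ha ha1)
  · simp_rw [enorm_gradient]
    exact (measurable_fderiv ℝ w).enorm.pow_const 2

end Scaling

/-! ### Convergence of mollifications in `L²` -/

section Mollification

open scoped Convolution

variable {E : Type*} [NormedAddCommGroup E] [InnerProductSpace ℝ E] [FiniteDimensional ℝ E]
  [MeasurableSpace E] [BorelSpace E] {F : Type*} [NormedAddCommGroup F]

theorem tendsto_eLpNorm_translate_sub {f : E → F} (hf : MemLp f 2 volume) :
    Tendsto (fun t : E => eLpNorm (fun x => f (x - t) - f x) 2 volume) (𝓝 0) (𝓝 0) := by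
  let g : C(E, C(E, E)) := (ContinuousMap.mk (fun p : E × E => p.2 - p.1)
    (by fun_prop)).curry
  have hg : ∀ t, MeasurePreserving (g t) (volume : Measure E) volume := fun t =>
    measurePreserving_sub_right volume t
  have hc := (continuous_const (y := hf.toLp f) (X := E)).compMeasurePreservingLp g.continuous hg
    ENNReal.ofNat_ne_top
  have h0 := (tendsto_iff_edist_tendsto_0.1 (hc.tendsto 0))
  refine h0.congr fun t => ?_
  rw [Lp.toLp_compMeasurePreserving, Lp.toLp_compMeasurePreserving, Lp.edist_toLp_toLp]
  congr 1
  ext x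
  simp [g]

theorem eLpNorm_two_sq {α G : Type*} [MeasurableSpace α] [NormedAddCommGroup G] {μ : Measure α}
    (f : α → G) : eLpNorm f 2 μ ^ 2 = ∫⁻ x, ‖f x‖ₑ ^ 2 ∂μ := by
  rw [eLpNorm_eq_lintegral_rpow_enorm_toReal two_ne_zero ENNReal.ofNat_ne_top,
    ← ENNReal.rpow_natCast, ← ENNReal.rpow_mul]
  simp

variable [NormedSpace ℝ F] [CompleteSpace F]

/-- Jensen's inequality for the probability measure whose density is the mollifier. -/
theorem enorm_convolution_sub_sq_le {f : E → F} (hf : LocallyIntegrable f volume)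
    (φ : ContDiffBump (0 : E)) (x : E) :
    ‖(φ.normed volume ⋆[ContinuousLinearMap.lsmul ℝ ℝ, volume] f) x - f x‖ₑ ^ 2 ≤
      ∫⁻ t, ENNReal.ofReal (φ.normed volume t) * ‖f (x - t) - f x‖ₑ ^ 2 := by
  set ρ := φ.normed volume with hρ
  have hρc : Continuous ρ := φ.continuous_normed
  have hρs : HasCompactSupport ρ := φ.hasCompactSupport_normed
  have hm : AEStronglyMeasurable (fun t => f (x - t) - f x) volume :=
    (hf.aestronglyMeasurable.comp_measurePreserving
      (Measure.measurePreserving_sub_left volume x)).sub aestronglyMeasurable_const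
  have hex : Integrable (fun t => ρ t • f (x - t)) volume :=
    (hρs.convolutionExists_left (ContinuousLinearMap.lsmul ℝ ℝ) hρc hf x)
  have hi1 : Integrable (fun t => ρ t • f x) volume := (φ.integrable_normed).smul_const _
  have h1 : (ρ ⋆[ContinuousLinearMap.lsmul ℝ ℝ, volume] f) x - f x =
      ∫ t, ρ t • (f (x - t) - f x) := by
    simp_rw [smul_sub]
    rw [integral_sub hex hi1, integral_smul_const, φ.integral_normed, one_smul]
    rfl
  set ν := (volume : Measure E).withDensity fun t => ENNReal.ofReal (ρ t) with hν
  have hρm : Measurable fun t => ENNReal.ofReal (ρ t) := hρc.measurable.ennreal_ofReal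
  have hνu : ν univ = 1 := by
    rw [hν, withDensity_apply _ MeasurableSet.univ, Measure.restrict_univ,
      ← ofReal_integral_eq_lintegral_ofReal φ.integrable_normed
        (Eventually.of_forall φ.nonneg_normed), φ.integral_normed, ENNReal.ofReal_one]
  have hnorm : ∀ t, ‖ρ t‖ₑ = ENNReal.ofReal (ρ t) := fun t => by
    rw [← ofReal_norm, Real.norm_of_nonneg (φ.nonneg_normed t)]
  have h2 : ‖∫ t, ρ t • (f (x - t) - f x)‖ₑ ≤ ∫⁻ t, ‖f (x - t) - f x‖ₑ ∂ν := by
    refine (enorm_integral_le_lintegral_enorm _).trans_eq ?_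
    rw [hν, lintegral_withDensity_eq_lintegral_mul₀ hρm.aemeasurable hm.enorm]
    refine lintegral_congr fun t => ?_
    rw [enorm_smul, hnorm]
    rfl
  rw [h1]
  refine (pow_le_pow_left' h2 2).trans ?_
  refine (sq_lintegral_le (hm.enorm.mono_ac (withDensity_absolutelyContinuous _ _))).trans_eq ?_
  rw [hνu, one_mul, lintegral_withDensity_eq_lintegral_mul₀ hρm.aemeasurable
    (hm.enorm.pow_const 2)]
  rfl

theorem lintegral_enorm_convolution_sub_sq_le {f : E → F} (hf : LocallyIntegrable f volume)
    (φ : ContDiffBump (0 : E)) {ε : ℝ≥0∞}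
    (hε : ∀ t ∈ Metric.ball (0 : E) φ.rOut, ∫⁻ x, ‖f (x - t) - f x‖ₑ ^ 2 ≤ ε) :
    ∫⁻ x, ‖(φ.normed volume ⋆[ContinuousLinearMap.lsmul ℝ ℝ, volume] f) x - f x‖ₑ ^ 2 ≤ ε := by
  have hρm : Measurable fun t => ENNReal.ofReal (φ.normed volume t) :=
    (φ.continuous_normed).measurable.ennreal_ofReal
  have hm : AEStronglyMeasurable (fun p : E × E => f (p.1 - p.2) - f p.1)
      ((volume : Measure E).prod volume) :=
    (hf.aestronglyMeasurable.comp_quasiMeasurePreserving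
      (quasiMeasurePreserving_sub volume volume)).sub
      (hf.aestronglyMeasurable.comp_quasiMeasurePreserving Measure.quasiMeasurePreserving_fst)
  calc ∫⁻ x, ‖(φ.normed volume ⋆[ContinuousLinearMap.lsmul ℝ ℝ, volume] f) x - f x‖ₑ ^ 2
      ≤ ∫⁻ x, ∫⁻ t, ENNReal.ofReal (φ.normed volume t) * ‖f (x - t) - f x‖ₑ ^ 2 :=
        lintegral_mono fun x => enorm_convolution_sub_sq_le hf φ x
    _ = ∫⁻ t, ∫⁻ x, ENNReal.ofReal (φ.normed volume t) * ‖f (x - t) - f x‖ₑ ^ 2 := by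
        refine lintegral_lintegral_swap ?_
        exact ((hρm.comp measurable_snd).aemeasurable).mul (hm.enorm.pow_const 2)
    _ = ∫⁻ t, ENNReal.ofReal (φ.normed volume t) * ∫⁻ x, ‖f (x - t) - f x‖ₑ ^ 2 :=
        lintegral_congr fun t => lintegral_const_mul' _ _ (by finiteness)
    _ ≤ ∫⁻ t, ENNReal.ofReal (φ.normed volume t) * ε := by
        refine lintegral_mono fun t => ?_
        by_cases ht : t ∈ Metric.ball (0 : E) φ.rOut
        · exact mul_le_mul_right (hε t ht) _
        · have : φ.normed volume t = 0 := by
            rw [← Function.notMem_support, φ.support_normed_eq]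
            exact ht
          simp [this]
    _ = ε := by
        rw [lintegral_mul_const _ hρm, ← ofReal_integral_eq_lintegral_ofReal φ.integrable_normed
          (Eventually.of_forall φ.nonneg_normed), φ.integral_normed, ENNReal.ofReal_one, one_mul]

theorem tendsto_eLpNorm_convolution_sub {f : E → F} (hf : MemLp f 2 volume)
    {φ : ℕ → ContDiffBump (0 : E)} (hφ : Tendsto (fun k => (φ k).rOut) atTop (𝓝 0)) :
    Tendsto (fun k => eLpNorm (fun x =>
      ((φ k).normed volume ⋆[ContinuousLinearMap.lsmul ℝ ℝ, volume] f) x - f x) 2 volume)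
      atTop (𝓝 0) := by
  have hli : LocallyIntegrable f volume := hf.locallyIntegrable one_le_two
  rw [ENNReal.tendsto_nhds_zero]
  intro ε hε
  have h1 := (ENNReal.tendsto_nhds_zero.1 (tendsto_eLpNorm_translate_sub hf)) ε hε
  obtain ⟨r, hr, hball⟩ := Metric.eventually_nhds_iff_ball.1 h1
  filter_upwards [hφ.eventually (gt_mem_nhds hr)] with k hk
  have h2 := lintegral_enorm_convolution_sub_sq_le hli (φ k) (ε := ε ^ 2) fun t ht => by
    rw [← eLpNorm_two_sq]
    exact pow_le_pow_left' (hball t (Metric.ball_subset_ball hk.le ht)) 2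
  rw [← eLpNorm_two_sq] at h2
  exact (ENNReal.pow_le_pow_left_iff two_ne_zero).1 h2

end Mollification

/-! ### Weak gradients: uniqueness and mollification -/

section WeakGradient

open scoped Convolution

variable {E : Type*} [NormedAddCommGroup E] [InnerProductSpace ℝ E] [FiniteDimensional ℝ E]
  [MeasurableSpace E] [BorelSpace E]

theorem integrable_smul_of_tsupport_subset {F : Type*} [NormedAddCommGroup F] [NormedSpace ℝ F]
    {U : Set E} {f : E → F} (hf : LocallyIntegrableOn f U) {φ : E → ℝ} (hφ : Continuous φ)
    (hc : HasCompactSupport φ) (hU : tsupport φ ⊆ U) : Integrable (fun x => φ x • f x) := by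
  have h1 : IntegrableOn f (tsupport φ) := hf.integrableOn_compact_subset hU hc
  have h2 := h1.continuousOn_smul hφ.continuousOn hc
  refine (integrableOn_iff_integrable_of_support_subset fun x hx => ?_).1 h2
  refine subset_tsupport _ fun h => hx ?_
  simp [h]

theorem setIntegral_smul_of_tsupport_subset {F : Type*} [NormedAddCommGroup F] [NormedSpace ℝ F]
    {U : Set E} (f : E → F) {φ : E → ℝ} (hU : tsupport φ ⊆ U) :
    ∫ x in U, φ x • f x = ∫ x, φ x • f x :=
  setIntegral_eq_integral_of_forall_compl_eq_zero fun x hx => by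
    rw [image_eq_zero_of_notMem_tsupport fun h => hx (hU h), zero_smul]

omit [MeasurableSpace E] [BorelSpace E] in
theorem continuous_gradient {φ : E → ℝ} (hφ : ContDiff ℝ 1 φ) : Continuous (gradient φ) :=
  (InnerProductSpace.toDual ℝ E).symm.continuous.comp (hφ.continuous_fderiv one_ne_zero)

omit [MeasurableSpace E] [BorelSpace E] in
theorem gradient_eq_zero_of_notMem_tsupport {φ : E → ℝ} {x : E} (hx : x ∉ tsupport φ) :
    gradient φ x = 0 := by
  rw [gradient, image_eq_zero_of_notMem_tsupport (f := fderiv ℝ φ)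
    fun h => hx (tsupport_fderiv_subset ℝ h), map_zero]

theorem integrable_gradient {φ : E → ℝ} (hφ : ContDiff ℝ 1 φ) (hc : HasCompactSupport φ) :
    Integrable (gradient φ) := by
  refine (continuous_gradient hφ).integrable_of_hasCompactSupport ?_
  exact (hc.fderiv ℝ).comp_left (g := (InnerProductSpace.toDual ℝ E).symm) (map_zero _)

theorem integral_gradient_eq_zero {φ : E → ℝ} (hφ : ContDiff ℝ 1 φ) (hc : HasCompactSupport φ) :
    ∫ x, gradient φ x = 0 := by
  refine ext_inner_left ℝ fun w => ?_
  rw [← integral_inner (integrable_gradient hφ hc), inner_zero_right]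
  have h := integral_mul_fderiv_eq_neg_fderiv_mul_of_integrable (μ := (volume : Measure E))
    (f := fun _ : E => (1 : ℝ)) (g := φ) (v := w) (by simp) ?_ ?_ (by fun_prop)
    (fun x _ => hφ.differentiable one_ne_zero x)
  · have h2 : ∀ x, inner ℝ w (gradient φ x) = 1 * fderiv ℝ φ x w := fun x => by
      rw [real_inner_comm, gradient, InnerProductSpace.toDual_symm_apply, one_mul]
    simp_rw [h2]
    rw [h]
    simp
  · simp only [one_mul]
    exact Continuous.integrable_of_hasCompactSupport
      ((hφ.continuous_fderiv one_ne_zero).clm_apply continuous_const) (hc.fderiv_apply ℝ w)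
  · simpa using hφ.continuous.integrable_of_hasCompactSupport hc

/-- The weak boundary condition comes with its own gradient of `v - 1`, which has to be identified
with the given gradient of `v`. The constant drops out because the gradient of a test function has
integral zero. -/
theorem HasWeakGradientOn.ae_eq_of_sub_const {U : Set E} (hU : IsOpen U) {v : E → ℝ} {a : ℝ}
    {g g' : E → E} (hg : HasWeakGradientOn U v g)
    (hg' : HasWeakGradientOn U (fun x => v x - a) g') :
    ∀ᵐ x, x ∈ U → g x = g' x := by
  have h := hU.ae_eq_zero_of_integral_contDiff_smul_eq_zero (f := fun x => g x - g' x)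
    (μ := volume) (hg.locallyIntegrableOn_grad.sub hg'.locallyIntegrableOn_grad)
    fun φ hφ hc hs => ?_
  · filter_upwards [h] with x hx hxU
    exact sub_eq_zero.1 (hx hxU)
  have hφ1 : ContDiff ℝ 1 φ := hφ.of_le (by simp)
  have h1 := hg.integral_eq φ hφ hc hs
  have h2 := hg'.integral_eq φ hφ hc hs
  have hz : ∀ x, x ∉ U → gradient φ x = 0 := fun x hx =>
    gradient_eq_zero_of_notMem_tsupport fun h => hx (hs h)
  have h3 : ∫ x in U, (v x - a) • gradient φ x = ∫ x in U, v x • gradient φ x := by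
    have e1 : ∀ u : E → ℝ, ∫ x in U, u x • gradient φ x = ∫ x, u x • gradient φ x := fun u =>
      setIntegral_eq_integral_of_forall_compl_eq_zero fun x hx => by rw [hz x hx, smul_zero]
    have e2 : Integrable fun x => v x • gradient φ x := by
      have h1 : IntegrableOn v (tsupport φ) :=
        hg.locallyIntegrableOn.integrableOn_compact_subset hs hc
      have h2 := h1.smul_continuousOn (continuous_gradient hφ1).continuousOn hc
      refine (integrableOn_iff_integrable_of_support_subset fun x hx => ?_).1 h2
      by_contra h
      exact hx (by simp [gradient_eq_zero_of_notMem_tsupport h])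
    have e3 : Integrable fun x => a • gradient φ x := (integrable_gradient hφ1 hc).smul a
    rw [e1, e1]
    simp_rw [sub_smul]
    rw [integral_sub e2 e3, integral_smul,
      integral_gradient_eq_zero hφ1 hc, smul_zero, sub_zero]
  rw [h3, h1, neg_inj, setIntegral_smul_of_tsupport_subset g hs,
    setIntegral_smul_of_tsupport_subset g' hs] at h2
  simp_rw [smul_sub]
  rw [integral_sub
    (integrable_smul_of_tsupport_subset hg.locallyIntegrableOn_grad hφ.continuous hc hs)
    (integrable_smul_of_tsupport_subset hg'.locallyIntegrableOn_grad hφ.continuous hc hs), h2,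
    sub_self]

/-- The weak formulation is tested with `y ↦ ρ (x - y)`, an admissible function because its support
lies in the closed ball about `x`. Hence the identity holds only at distance from the boundary of
`U`. -/
theorem HasWeakGradientOn.gradient_convolution_eq {U : Set E} (hU : MeasurableSet U) {v : E → ℝ}
    {g : E → E} (hg : HasWeakGradientOn U v g) (hv : LocallyIntegrable (U.indicator v))
    (φ : ContDiffBump (0 : E)) {x : E} (hx : Metric.closedBall x φ.rOut ⊆ U) :
    gradient (φ.normed volume ⋆[ContinuousLinearMap.lsmul ℝ ℝ, volume] U.indicator v) x =
      (φ.normed volume ⋆[ContinuousLinearMap.lsmul ℝ ℝ, volume] U.indicator g) x := by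
  set ρ := φ.normed volume with hρ
  have hρs : HasCompactSupport ρ := φ.hasCompactSupport_normed
  have hρc : ContDiff ℝ ∞ ρ := φ.contDiff_normed
  have hρ1 : ContDiff ℝ 1 ρ := φ.contDiff_normed
  set ψ : E → ℝ := fun y => ρ (x - y) with hψ
  have hψc : ContDiff ℝ ∞ ψ := hρc.comp (contDiff_const.sub contDiff_id)
  have hψt : tsupport ψ ⊆ Metric.closedBall x φ.rOut := by
    refine closure_minimal (fun y hy => ?_) Metric.isClosed_closedBall
    have : x - y ∈ Function.support ρ := hy
    rw [hρ, φ.support_normed_eq, mem_ball_zero_iff] at this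
    rw [mem_closedBall_iff_norm']
    exact this.le
  have hψs : HasCompactSupport ψ :=
    (isCompact_closedBall _ _).of_isClosed_subset (isClosed_tsupport _) hψt
  have hψg : ∀ y, gradient ψ y = -gradient ρ (x - y) := fun y => by
    have := ((hρ1.differentiable one_ne_zero (x - y)).hasFDerivAt.comp y
      ((hasFDerivAt_id y).const_sub x)).fderiv
    rw [gradient, gradient, ← map_neg]
    congr 1
    refine (show fderiv ℝ ψ y = _ from this).trans ?_
    ext w
    simp
  have h1 := hg.integral_eq ψ hψc hψs (hψt.trans hx)
  have h2 := hρs.hasFDerivAt_convolution_left (ContinuousLinearMap.lsmul ℝ ℝ) hρ1 hv x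
  have h3 : gradient (ρ ⋆[ContinuousLinearMap.lsmul ℝ ℝ, volume] U.indicator v) x =
      ∫ y, U.indicator v y • gradient ρ (x - y) := by
    rw [gradient, h2.fderiv, convolution_eq_swap,
      ← LinearIsometryEquiv.coe_toContinuousLinearEquiv,
      ← ContinuousLinearEquiv.integral_comp_comm]
    refine integral_congr_ae (Eventually.of_forall fun y => ?_)
    refine ext_inner_right ℝ fun w => ?_
    simp [gradient, inner_smul_left, -ContinuousLinearEquiv.coe_coe]
    exact mul_comm _ _
  have h4 : ∫ y, U.indicator v y • gradient ρ (x - y) = -∫ y in U, v y • gradient ψ y := by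
    rw [← integral_neg, ← integral_indicator hU]
    refine integral_congr_ae (Eventually.of_forall fun y => ?_)
    by_cases hy : y ∈ U
    · simp only [indicator_of_mem hy, hψg, smul_neg, neg_neg]
    · simp only [indicator_of_notMem hy, zero_smul]
  rw [h3, h4, h1, neg_neg, convolution_eq_swap, ← integral_indicator hU]
  refine integral_congr_ae (Eventually.of_forall fun y => ?_)
  by_cases hy : y ∈ U
  · simp only [indicator_of_mem hy, hψ, ContinuousLinearMap.lsmul_apply]
  · simp only [indicator_of_notMem hy, map_zero]

end WeakGradient

/-! ### Smooth approximation that respects the weak boundary condition -/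

section Approximation

open scoped Convolution Manifold

variable {E : Type*} [NormedAddCommGroup E] [InnerProductSpace ℝ E] [FiniteDimensional ℝ E]

theorem exists_contDiff_cutoff {K O : Set E} (hK : IsCompact K) (hO : IsOpen O) (hKO : K ⊆ O) :
    ∃ χ : E → ℝ, ContDiff ℝ ∞ χ ∧ HasCompactSupport χ ∧ tsupport χ ⊆ O ∧
      (∀ x, χ x ∈ Icc (0 : ℝ) 1) ∧ K ⊆ interior {x | χ x = 1} := by
  obtain ⟨L, hL, hKL, hLO⟩ := exists_compact_between hK hO hKO
  obtain ⟨f, h1, h0, hf⟩ := exists_contMDiffMap_one_nhds_of_subset_interior (n := (⊤ : ℕ∞)) 𝓘(ℝ, E)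
    hK.isClosed hKL
  have hts : tsupport f ⊆ L := closure_minimal (fun x hx => by
    by_contra h
    exact hx (h0 x h)) hL.isClosed
  exact ⟨f, f.contMDiff.contDiff, hL.of_isClosed_subset (isClosed_tsupport _) hts, hts.trans hLO,
    hf, subset_interior_iff_mem_nhdsSet.2 h1⟩

omit [FiniteDimensional ℝ E] in
theorem contDiff_mul_of_tsupport_subset {χ w : E → ℝ} {O : Set E} (hO : IsOpen O)
    (hχ : ContDiff ℝ ∞ χ) (hs : tsupport χ ⊆ O) (hw : ContDiffOn ℝ ∞ w O) :
    ContDiff ℝ ∞ fun x => χ x * w x := by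
  refine contDiff_iff_contDiffAt.2 fun x => ?_
  by_cases hx : x ∈ tsupport χ
  · exact hχ.contDiffAt.mul (hw.contDiffAt (hO.mem_nhds (hs hx)))
  · refine (contDiffAt_const (c := (0 : ℝ))).congr_of_eventuallyEq ?_
    filter_upwards [(isClosed_tsupport χ).isOpen_compl.mem_nhds hx] with y hy
    rw [image_eq_zero_of_notMem_tsupport hy, zero_mul]

theorem ENNReal.add_add_sq_le (a b c d : ℝ≥0∞) :
    (a + b + (c + d)) ^ 2 ≤ 4 * a ^ 2 + 4 * b ^ 2 + (4 * c ^ 2 + 4 * d ^ 2) := by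
  calc (a + b + (c + d)) ^ 2 ≤ 2 * (a + b) ^ 2 + 2 * (c + d) ^ 2 := ENNReal.add_sq_le_two_mul _ _
    _ ≤ 2 * (2 * a ^ 2 + 2 * b ^ 2) + 2 * (2 * c ^ 2 + 2 * d ^ 2) := by
      gcongr <;> exact ENNReal.add_sq_le_two_mul _ _
    _ = _ := by ring

/-- Pointwise bounds for the function obtained by gluing `c` and `u + 1` with a cutoff `χ`. -/
theorem enorm_glue_sub_sq_le {χ c u v : E → ℝ} {g : E → E} {O : Set E} (hO : IsOpen O)
    (hχ : ContDiff ℝ ∞ χ) (hχO : tsupport χ ⊆ O) (hχ01 : ∀ x, χ x ∈ Icc (0 : ℝ) 1)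
    {M : ℝ} (hM : ∀ x, ‖gradient χ x‖ ≤ M) (hc : ContDiff ℝ ∞ c) (hu : ContDiffOn ℝ ∞ u O)
    (x : E) :
    ‖c x + χ x * (u x + 1 - c x) - v x‖ₑ ^ 2 ≤
        2 * ‖c x - v x‖ₑ ^ 2 + O.indicator (fun x => 2 * ‖u x - (v x - 1)‖ₑ ^ 2) x ∧
    ‖gradient (fun x => c x + χ x * (u x + 1 - c x)) x - g x‖ₑ ^ 2 ≤
        4 * ‖gradient c x - g x‖ₑ ^ 2 + 4 * (ENNReal.ofReal M * ‖c x - v x‖ₑ) ^ 2 +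
        O.indicator (fun x => 4 * ‖gradient u x - g x‖ₑ ^ 2 +
          4 * (ENNReal.ofReal M * ‖u x - (v x - 1)‖ₑ) ^ 2) x := by
  have hcd : DifferentiableAt ℝ c x := hc.differentiable (by simp) x
  have hχd : DifferentiableAt ℝ χ x := hχ.differentiable (by simp) x
  have hMe : ‖gradient χ x‖ₑ ≤ ENNReal.ofReal M := by
    rw [← ofReal_norm]
    exact ENNReal.ofReal_le_ofReal (hM x)
  have hχ1 : ‖χ x‖ₑ ≤ 1 := by
    rw [← ofReal_norm, Real.norm_of_nonneg (hχ01 x).1]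
    exact ENNReal.ofReal_le_one.2 (hχ01 x).2
  have hχ2 : ‖1 - χ x‖ₑ ≤ 1 := by
    rw [← ofReal_norm, Real.norm_of_nonneg (by linarith [(hχ01 x).2])]
    exact ENNReal.ofReal_le_one.2 (by linarith [(hχ01 x).1])
  by_cases hx : x ∈ O
  · rw [indicator_of_mem hx, indicator_of_mem hx]
    constructor
    -- A convex combination of two errors that tend to zero separately. In the gradient, `∇χ` is
    -- likewise multiplied only by such errors, since `u + 1 - c = (u - (v - 1)) - (c - v)`.
    · have e : c x + χ x * (u x + 1 - c x) - v x =
          (1 - χ x) * (c x - v x) + χ x * (u x - (v x - 1)) := by ring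
      rw [e]
      refine (pow_le_pow_left' ((enorm_add_le _ _).trans (add_le_add ?_ ?_)) 2).trans
        (ENNReal.add_sq_le_two_mul _ _)
      · rw [enorm_mul]
        exact mul_le_of_le_one_left' hχ2
      · rw [enorm_mul]
        exact mul_le_of_le_one_left' hχ1
    · have hud : DifferentiableAt ℝ u x :=
        (hu.contDiffAt (hO.mem_nhds hx)).differentiableAt (by simp)
      have hgrad : gradient (fun x => c x + χ x * (u x + 1 - c x)) x =
          gradient c x + (χ x • (gradient u x - gradient c x) +
            (u x + 1 - c x) • gradient χ x) := by
        have h1 : fderiv ℝ (fun x => c x + χ x * (u x + 1 - c x)) x =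
            fderiv ℝ c x + (χ x • (fderiv ℝ u x - fderiv ℝ c x) +
              (u x + 1 - c x) • fderiv ℝ χ x) := by
          rw [fderiv_fun_add hcd (hχd.fun_mul ((hud.add_const 1).fun_sub hcd)),
            fderiv_fun_mul hχd ((hud.add_const 1).fun_sub hcd),
            fderiv_fun_sub (hud.add_const 1) hcd, fderiv_add_const]
        simp only [gradient, h1, map_add, map_sub, LinearIsometryEquiv.map_smulₛₗ,
          conj_trivial]
      have e : gradient (fun x => c x + χ x * (u x + 1 - c x)) x - g x =
          ((1 - χ x) • (gradient c x - g x) + -((c x - v x) • gradient χ x)) +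
          (χ x • (gradient u x - g x) + (u x - (v x - 1)) • gradient χ x) := by
        rw [hgrad]
        module
      rw [e]
      refine (pow_le_pow_left' ((enorm_add_le _ _).trans (add_le_add
        ((enorm_add_le _ _).trans (add_le_add ?_ ?_))
        ((enorm_add_le _ _).trans (add_le_add ?_ ?_)))) 2).trans (ENNReal.add_add_sq_le _ _ _ _)
      · rw [enorm_smul]
        exact mul_le_of_le_one_left' hχ2
      · rw [enorm_neg, enorm_smul, mul_comm]
        gcongr
      · rw [enorm_smul]
        exact mul_le_of_le_one_left' hχ1
      · rw [enorm_smul, mul_comm]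
        gcongr
  · have hxt : x ∉ tsupport χ := fun h => hx (hχO h)
    rw [indicator_of_notMem hx, indicator_of_notMem hx, add_zero, add_zero]
    constructor
    · rw [image_eq_zero_of_notMem_tsupport hxt, zero_mul, add_zero]
      exact le_mul_of_one_le_left zero_le one_le_two
    · have hgrad : gradient (fun x => c x + χ x * (u x + 1 - c x)) x = gradient c x := by
        rw [gradient, gradient]
        congr 1
        refine Filter.EventuallyEq.fderiv_eq ?_
        filter_upwards [(isClosed_tsupport χ).isOpen_compl.mem_nhds hxt] with y hy
        rw [image_eq_zero_of_notMem_tsupport hy, zero_mul, add_zero]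
      rw [hgrad]
      exact (le_mul_of_one_le_left zero_le (by norm_num)).trans le_self_add

variable [MeasurableSpace E] [BorelSpace E]

/-- A function of `H¹(U)` that equals `1` weakly on `A` is approximated in `H¹`, away from the
boundary of `U`, by smooth functions that equal `1` near `A`. -/
theorem IsH1With.exists_contDiff_approx {U A S : Set E} (hU : IsOpen U)
    (hA : IsCompact (closure A)) (hAU : closure A ⊆ U) (hS : MeasurableSet S) {r : ℝ} (hr : 0 < r)
    (hSU : ∀ x ∈ S, Metric.closedBall x r ⊆ U) {v : E → ℝ} {g : E → E} (hv : IsH1With U v g)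
    (hEq : EqWeaklyOn U A v 1) :
    ∃ V : ℕ → E → ℝ, (∀ k, ContDiff ℝ ∞ (V k)) ∧
      (∀ k, ∃ O, IsOpen O ∧ A ⊆ O ∧ ∀ x ∈ O, V k x = 1) ∧
      Tendsto (fun k => ∫⁻ x in S, ‖V k x - v x‖ₑ ^ 2) atTop (𝓝 0) ∧
      Tendsto (fun k => ∫⁻ x in S, ‖gradient (V k) x - g x‖ₑ ^ 2) atTop (𝓝 0) := by
  obtain ⟨g', hg', W, hW, hAW, u, huc, hus, hu1, hu2⟩ := hEq
  set O := U ∩ W with hOdef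
  have hO : IsOpen O := hU.inter hW
  obtain ⟨χ, hχ, hχs, hχO, hχ01, hχ1⟩ := exists_contDiff_cutoff hA hO (subset_inter hAU hAW)
  obtain ⟨M, hM⟩ : ∃ M, ∀ x, ‖gradient χ x‖ ≤ M :=
    (continuous_gradient (hχ.of_le (by simp))).bounded_above_of_compact_support
      ((hχs.fderiv ℝ).comp_left (g := (InnerProductSpace.toDual ℝ E).symm) (map_zero _))
  have hgg := hv.hasWeakGradientOn.ae_eq_of_sub_const hU hg'.hasWeakGradientOn
  have hf : MemLp (U.indicator v) 2 volume :=
    (memLp_indicator_iff_restrict hU.measurableSet).2 hv.memLp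
  have hG : MemLp (U.indicator g) 2 volume :=
    (memLp_indicator_iff_restrict hU.measurableSet).2 hv.memLp_grad
  let φ : ℕ → ContDiffBump (0 : E) := fun k =>
    ⟨r / (k + 2) / 2, r / (k + 2), by positivity, half_lt_self (by positivity)⟩
  have hφ : Tendsto (fun k => (φ k).rOut) atTop (𝓝 0) :=
    tendsto_const_nhds.div_atTop
      (tendsto_atTop_add_const_right _ _ tendsto_natCast_atTop_atTop)
  have hφr : ∀ k, (φ k).rOut ≤ r := fun k => by
    change r / (k + 2) ≤ r
    exact div_le_self hr.le (by linarith [(Nat.cast_nonneg k : (0 : ℝ) ≤ k)])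
  set c : ℕ → E → ℝ := fun k =>
    (φ k).normed volume ⋆[ContinuousLinearMap.lsmul ℝ ℝ, volume] U.indicator v with hc
  have hcc : ∀ k, ContDiff ℝ ∞ (c k) := fun k =>
    ((φ k).hasCompactSupport_normed).contDiff_convolution_left _ (φ k).contDiff_normed
      (hf.locallyIntegrable one_le_two)
  have hSU' : S ⊆ U := fun x hx => hSU x hx (Metric.mem_closedBall_self hr.le)
  have hsq : ∀ {f : ℕ → ℝ≥0∞}, Tendsto f atTop (𝓝 0) →
      Tendsto (fun k => f k ^ 2) atTop (𝓝 0) := fun h => by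
    simpa using ENNReal.Tendsto.pow (n := 2) h
  have hc1 : Tendsto (fun k => ∫⁻ x in S, ‖c k x - v x‖ₑ ^ 2) atTop (𝓝 0) := by
    refine tendsto_of_tendsto_of_tendsto_of_le_of_le tendsto_const_nhds
      (hsq (tendsto_eLpNorm_convolution_sub hf hφ)) (fun _ => zero_le) fun k => ?_
    rw [eLpNorm_two_sq]
    refine le_trans (le_of_eq ?_) (setLIntegral_le_lintegral S _)
    refine setLIntegral_congr_fun hS fun x hx => ?_
    simp only [hc, indicator_of_mem (hSU' hx)]
  have hc2 : Tendsto (fun k => ∫⁻ x in S, ‖gradient (c k) x - g x‖ₑ ^ 2) atTop (𝓝 0) := by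
    refine tendsto_of_tendsto_of_tendsto_of_le_of_le tendsto_const_nhds
      (hsq (tendsto_eLpNorm_convolution_sub hG hφ)) (fun _ => zero_le) fun k => ?_
    rw [eLpNorm_two_sq]
    refine le_trans (le_of_eq ?_) (setLIntegral_le_lintegral S _)
    refine setLIntegral_congr_fun hS fun x hx => ?_
    simp only [hc]
    rw [hv.hasWeakGradientOn.gradient_convolution_eq hU.measurableSet
      (hf.locallyIntegrable one_le_two) (φ k)
      ((Metric.closedBall_subset_closedBall (hφr k)).trans (hSU x hx)),
      indicator_of_mem (hSU' hx)]
  have hb1 : Tendsto (fun k => ∫⁻ x in O, ‖u k x - (v x - 1)‖ₑ ^ 2) atTop (𝓝 0) := by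
    simpa only [eLpNorm_two_sq] using hsq hu1
  have hb2 : Tendsto (fun k => ∫⁻ x in O, ‖gradient (u k) x - g' x‖ₑ ^ 2) atTop (𝓝 0) := by
    simpa only [eLpNorm_two_sq] using hsq hu2
  have hmO : ∀ k, AEMeasurable (fun x => ‖u k x - (v x - 1)‖ₑ ^ 2) (volume.restrict O) := fun k =>
    ((((huc k).continuousOn.aestronglyMeasurable hO.measurableSet).sub
      (((hv.memLp.1.mono_measure (Measure.restrict_mono inter_subset_left le_rfl)).sub
        aestronglyMeasurable_const))).enorm).pow_const 2
  have hmS : ∀ k, AEMeasurable (fun x => ‖c k x - v x‖ₑ ^ 2) (volume.restrict S) := fun k =>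
    (((hcc k).continuous.aestronglyMeasurable).sub
      (hv.memLp.1.mono_measure (Measure.restrict_mono hSU' le_rfl))).enorm.pow_const 2
  have hmS2 : ∀ k, AEMeasurable (fun x => ‖gradient (c k) x - g x‖ₑ ^ 2) (volume.restrict S) :=
    fun k => (((continuous_gradient ((hcc k).of_le (by simp))).aestronglyMeasurable).sub
      (hv.memLp_grad.1.mono_measure (Measure.restrict_mono hSU' le_rfl))).enorm.pow_const 2
  have hind : ∀ F : E → ℝ≥0∞, ∫⁻ x in S, O.indicator F x ≤ ∫⁻ x in O, F x := fun F =>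
    (setLIntegral_le_lintegral _ _).trans_eq (lintegral_indicator hO.measurableSet _)
  have hlim : ∀ {f : ℕ → ℝ≥0∞} (a : ℝ≥0∞), a ≠ ⊤ → Tendsto f atTop (𝓝 0) →
      Tendsto (fun k => a * f k) atTop (𝓝 0) := fun a ha h => by
    simpa using ENNReal.Tendsto.const_mul h (Or.inr ha)
  -- Mollification away from `A`, and `u k + 1` near `A`, where `u k` approximates `v - 1`.
  refine ⟨fun k x => c k x + χ x * (u k x + 1 - c k x), fun k => ?_, fun k => ?_, ?_, ?_⟩
  · exact (hcc k).add (contDiff_mul_of_tsupport_subset hO hχ hχO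
      (((huc k).add contDiffOn_const).sub (hcc k).contDiffOn))
  -- Here `χ = 1` and `u k = 0`, so the glued function is `1`. The set contains `A` because the
  -- closed support of `u k` misses `A`.
  · refine ⟨interior {x | χ x = 1} ∩ (O ∩ (closure {x | x ∈ O ∧ u k x ≠ 0})ᶜ),
      isOpen_interior.inter (hO.inter isClosed_closure.isOpen_compl),
      fun x hx => ⟨?_, ⟨?_, ?_⟩, ?_⟩,
      fun x hx => ?_⟩
    · exact hχ1 (subset_closure hx)
    · exact hAU (subset_closure hx)
    · exact hAW (subset_closure hx)
    · exact (hus k).notMem_of_mem_left hx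
    · have h1 : χ x = 1 := interior_subset (s := {x | χ x = 1}) hx.1
      have h2 : u k x = 0 := by
        by_contra h
        exact hx.2.2 (subset_closure ⟨hx.2.1, h⟩)
      simp only [h1, h2]
      ring
  · have hlim0 := (hlim 2 (by finiteness) hc1).add (hlim 2 (by finiteness) hb1)
    rw [add_zero] at hlim0
    refine tendsto_of_tendsto_of_tendsto_of_le_of_le tendsto_const_nhds hlim0
      (fun _ => zero_le) fun k => ?_
    calc ∫⁻ x in S, ‖c k x + χ x * (u k x + 1 - c k x) - v x‖ₑ ^ 2
        ≤ ∫⁻ x in S, (2 * ‖c k x - v x‖ₑ ^ 2 +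
            O.indicator (fun x => 2 * ‖u k x - (v x - 1)‖ₑ ^ 2) x) :=
          lintegral_mono fun x =>
            (enorm_glue_sub_sq_le (g := g) hO hχ hχO hχ01 hM (hcc k) (huc k) x).1
      _ = 2 * (∫⁻ x in S, ‖c k x - v x‖ₑ ^ 2) +
            ∫⁻ x in S, O.indicator (fun x => 2 * ‖u k x - (v x - 1)‖ₑ ^ 2) x := by
          rw [lintegral_add_left' ((hmS k).const_mul 2), lintegral_const_mul' _ _ (by finiteness)]
      _ ≤ 2 * (∫⁻ x in S, ‖c k x - v x‖ₑ ^ 2) + 2 * ∫⁻ x in O, ‖u k x - (v x - 1)‖ₑ ^ 2 := by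
          gcongr
          exact (hind _).trans_eq (lintegral_const_mul' _ _ (by finiteness))
  · have hMt : 4 * ENNReal.ofReal M ^ 2 ≠ ⊤ := by finiteness
    have hlim0 := ((hlim 4 (by finiteness) hc2).add (hlim _ hMt hc1)).add
      ((hlim 4 (by finiteness) hb2).add (hlim _ hMt hb1))
    simp only [add_zero] at hlim0
    refine tendsto_of_tendsto_of_tendsto_of_le_of_le tendsto_const_nhds hlim0
      (fun _ => zero_le) fun k => ?_
    have hgO : ∫⁻ x in O, ‖gradient (u k) x - g x‖ₑ ^ 2 =
        ∫⁻ x in O, ‖gradient (u k) x - g' x‖ₑ ^ 2 := by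
      refine lintegral_congr_ae ?_
      filter_upwards [ae_restrict_of_ae hgg, ae_restrict_mem hO.measurableSet] with x hx hxO
      rw [hx hxO.1]
    calc ∫⁻ x in S, ‖gradient (fun x => c k x + χ x * (u k x + 1 - c k x)) x - g x‖ₑ ^ 2
        ≤ ∫⁻ x in S, (4 * ‖gradient (c k) x - g x‖ₑ ^ 2 +
            4 * ENNReal.ofReal M ^ 2 * ‖c k x - v x‖ₑ ^ 2 +
            O.indicator (fun x => 4 * ‖gradient (u k) x - g x‖ₑ ^ 2 +
              4 * ENNReal.ofReal M ^ 2 * ‖u k x - (v x - 1)‖ₑ ^ 2) x) := by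
          refine lintegral_mono fun x => ?_
          simpa only [mul_pow, ← mul_assoc] using
            (enorm_glue_sub_sq_le (v := v) (g := g) hO hχ hχO hχ01 hM (hcc k) (huc k) x).2
      _ = 4 * (∫⁻ x in S, ‖gradient (c k) x - g x‖ₑ ^ 2) +
            4 * ENNReal.ofReal M ^ 2 * (∫⁻ x in S, ‖c k x - v x‖ₑ ^ 2) +
            ∫⁻ x in S, O.indicator (fun x => 4 * ‖gradient (u k) x - g x‖ₑ ^ 2 +
              4 * ENNReal.ofReal M ^ 2 * ‖u k x - (v x - 1)‖ₑ ^ 2) x := by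
          have hm : AEMeasurable (fun x => 4 * ‖gradient (c k) x - g x‖ₑ ^ 2 +
              4 * ENNReal.ofReal M ^ 2 * ‖c k x - v x‖ₑ ^ 2) (volume.restrict S) :=
            ((hmS2 k).const_mul 4).add ((hmS k).const_mul _)
          rw [lintegral_add_left' hm,
            lintegral_add_left' ((hmS2 k).const_mul 4), lintegral_const_mul' _ _ (by finiteness),
            lintegral_const_mul' _ _ hMt]
      _ ≤ _ := by
          gcongr
          refine (hind _).trans_eq ?_
          rw [lintegral_add_right' _ ((hmO k).const_mul _),
            lintegral_const_mul' _ _ (by finiteness),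
            lintegral_const_mul' _ _ hMt, hgO]

end Approximation

/-! ### Passing to the limit in the inequalities -/

section Limits

theorem ENNReal.tendsto_zero_of_sq {ι : Type*} {l : Filter ι} {f : ι → ℝ≥0∞}
    (h : Tendsto (fun k => f k ^ 2) l (𝓝 0)) : Tendsto f l (𝓝 0) := by
  rw [ENNReal.tendsto_nhds_zero] at h ⊢
  intro ε hε
  filter_upwards [h (ε ^ 2) (ENNReal.pow_pos hε 2)] with k hk
  exact (ENNReal.pow_le_pow_left_iff two_ne_zero).1 hk

/-- The capacity `c` is not known to be finite here, and multiplication by `⊤` is discontinuous at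
`0`; the case of a vanishing limit is therefore separate, and trivial. -/
theorem ENNReal.ofReal_mul_le_of_tendsto {ι : Type*} {l : Filter ι} [l.NeBot] {a : ι → ℝ} {a₀ : ℝ}
    {b : ι → ℝ≥0∞} {b₀ c : ℝ≥0∞} (ha : Tendsto a l (𝓝 a₀)) (hb : Tendsto b l (𝓝 b₀))
    (h : ∀ k, ENNReal.ofReal (a k) * c ≤ b k) : ENNReal.ofReal a₀ * c ≤ b₀ := by
  rcases eq_or_ne (ENNReal.ofReal a₀) 0 with h0 | h0
  · rw [h0, zero_mul]
    exact zero_le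
  · exact le_of_tendsto_of_tendsto'
      (ENNReal.Tendsto.mul_const (ENNReal.tendsto_ofReal ha) (Or.inl h0)) hb h

theorem tendsto_setAverage_of_lintegral_sq {α : Type*} [MeasurableSpace α] {μ : Measure α}
    {S : Set α} (hS0 : μ S ≠ 0) (hS : μ S ≠ ⊤) {V : ℕ → α → ℝ} {v : α → ℝ}
    (hV : ∀ k, IntegrableOn (V k) S μ) (hv : IntegrableOn v S μ)
    (h : Tendsto (fun k => ∫⁻ x in S, ‖V k x - v x‖ₑ ^ 2 ∂μ) atTop (𝓝 0)) :
    Tendsto (fun k => ⨍ x in S, V k x ∂μ) atTop (𝓝 (⨍ x in S, v x ∂μ)) := by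
  have : IsFiniteMeasure (μ.restrict S) := ⟨by simpa using hS.lt_top⟩
  rw [tendsto_iff_edist_tendsto_0]
  refine ENNReal.tendsto_zero_of_sq ?_
  have hlim : Tendsto (fun k => (μ S)⁻¹ * ∫⁻ x in S, ‖V k x - v x‖ₑ ^ 2 ∂μ) atTop (𝓝 0) := by
    simpa using ENNReal.Tendsto.const_mul h (Or.inr (by simpa using hS0))
  refine tendsto_of_tendsto_of_tendsto_of_le_of_le tendsto_const_nhds hlim (fun _ => zero_le)
    fun k => ?_
  have e : (⨍ x in S, V k x ∂μ) - ⨍ x in S, v x ∂μ = ⨍ x in S, (V k x - v x) ∂μ := by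
    rw [setAverage_eq, setAverage_eq, setAverage_eq, ← smul_sub, integral_sub (hV k) hv]
  have h1 := enorm_average_sq_le (μ := μ.restrict S) ((hV k).sub hv).1
  rw [Measure.restrict_apply_univ] at h1
  simp only [edist_eq_enorm_sub, e]
  exact h1

end Limits

/-! ### From smooth functions to `H¹`, and the conclusion -/

section Main

variable {N : ℕ}

theorem closedBall_subset_openCylinder {l h a : ℝ} {x : SplitSpace N}
    (hx : x ∈ openCylinder N (a * l) (a * h)) :
    Metric.closedBall x (min ((1 - a) * l) ((1 - a) * h)) ⊆ openCylinder N l h := fun y hy => by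
  have h1 := mem_ball_zero_iff.1 hx.1
  have h2 := abs_lt.2 hx.2
  have h3 : ‖y - x‖ ≤ _ := mem_closedBall_iff_norm.1 hy
  have h4 : ‖y.fst - x.fst‖ ≤ ‖y - x‖ := norm_fst_le_norm (y - x)
  have h5 : |y.snd - x.snd| ≤ ‖y - x‖ := by
    rw [WithLp.prod_norm_eq_of_L2 (y - x)]
    refine Real.le_sqrt_of_sq_le ?_
    have : ‖(y - x).snd‖ ^ 2 = |y.snd - x.snd| ^ 2 := rfl
    rw [this]
    nlinarith [sq_nonneg ‖(y - x).fst‖]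
  have h6 := h3.trans (min_le_left _ _)
  have h7 := h3.trans (min_le_right _ _)
  constructor
  · rw [mem_ball_zero_iff]
    have := norm_le_norm_add_norm_sub' y.fst x.fst
    linarith
  · refine abs_lt.1 ?_
    have := abs_add_le (y.snd - x.snd) x.snd
    rw [sub_add_cancel] at this
    linarith

theorem closure_flatSet_subset {K' : Set (EuclideanSpace ℝ (Fin (N - 1)))} {r : ℝ}
    (hr : K' ⊆ Metric.ball 0 r) :
    closure (flatSet K' : Set (SplitSpace N)) ⊆ {x | ‖x.fst‖ ≤ r ∧ x.snd = 0} := by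
  refine closure_minimal (fun x hx => ⟨(mem_ball_zero_iff.1 (hr hx.1)).le, hx.2⟩) ?_
  exact (isClosed_le (WithLp.continuous_fst 2 _ _).norm continuous_const).inter
    (isClosed_eq (WithLp.continuous_snd 2 _ _) continuous_const)

theorem isCompact_closure_flatSet {K' : Set (EuclideanSpace ℝ (Fin (N - 1)))}
    (hK' : Bornology.IsBounded K') : IsCompact (closure (flatSet K' : Set (SplitSpace N))) := by
  obtain ⟨r, hr⟩ := hK'.subset_ball (0 : EuclideanSpace ℝ (Fin (N - 1)))
  refine (Metric.isBounded_ball (x := (0 : SplitSpace N)) (r := r)).subset (fun x hx => ?_)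
    |>.isCompact_closure
  rw [mem_ball_zero_iff, norm_eq_norm_fst_of_mem_flatSet hx]
  exact mem_ball_zero_iff.1 (hr hx.1)

theorem openCylinder_mono {l h l' h' : ℝ} (hl : l ≤ l') (hh : h ≤ h') :
    openCylinder N l h ⊆ openCylinder N l' h' := fun _ hx =>
  ⟨Metric.ball_subset_ball hl hx.1, Ioo_subset_Ioo (neg_le_neg hh) hh hx.2⟩

theorem volume_openCylinder_ne_top (l h : ℝ) : volume (openCylinder N l h) ≠ ⊤ := by
  rw [volume_openCylinder]
  exact ENNReal.mul_ne_top measure_ball_lt_top.ne (by simp)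

theorem volume_openCylinder_ne_zero {l h : ℝ} (hl : 0 < l) (hh : 0 < h) :
    volume (openCylinder N l h) ≠ 0 := by
  rw [volume_openCylinder]
  refine mul_ne_zero (Metric.measure_ball_pos _ _ hl).ne' ?_
  rw [Real.volume_Ioo]
  exact (ENNReal.ofReal_pos.2 (by linarith)).ne'

theorem tendsto_setAverage_openCylinder {l h : ℝ} (hl : 0 < l) (hh : 0 < h)
    {v : SplitSpace N → ℝ} (hv : IntegrableOn v (openCylinder N l h)) {a : ℕ → ℝ}
    (ha : Monotone a) (ha1 : ∀ j, a j ≤ 1) (hlim : Tendsto a atTop (𝓝 1)) :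
    Tendsto (fun j => ⨍ x in openCylinder N (a j * l) (a j * h), v x) atTop
      (𝓝 (⨍ x in openCylinder N l h, v x)) := by
  have hmono : Monotone fun j => openCylinder N (a j * l) (a j * h) := fun i j hij =>
    openCylinder_mono (mul_le_mul_of_nonneg_right (ha hij) hl.le)
      (mul_le_mul_of_nonneg_right (ha hij) hh.le)
  have hU : ⋃ j, openCylinder N (a j * l) (a j * h) = openCylinder N l h := by
    refine Subset.antisymm (iUnion_subset fun j => openCylinder_mono
      (mul_le_of_le_one_left hl.le (ha1 j)) (mul_le_of_le_one_left hh.le (ha1 j))) fun x hx => ?_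
    have h1 := mem_ball_zero_iff.1 hx.1
    have h2 := abs_lt.2 hx.2
    have e1 : Tendsto (fun j => a j * l) atTop (𝓝 l) := by simpa using hlim.mul_const l
    have e2 : Tendsto (fun j => a j * h) atTop (𝓝 h) := by simpa using hlim.mul_const h
    obtain ⟨j, hj1, hj2⟩ := ((e1.eventually (lt_mem_nhds h1)).and
      (e2.eventually (lt_mem_nhds h2))).exists
    exact mem_iUnion.2 ⟨j, mem_ball_zero_iff.2 hj1, abs_lt.1 hj2⟩
  have key : ∀ f : SplitSpace N → ℝ, IntegrableOn f (openCylinder N l h) →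
      Tendsto (fun j => ∫ x in openCylinder N (a j * l) (a j * h), f x) atTop
        (𝓝 (∫ x in openCylinder N l h, f x)) := fun f hf => by
    rw [← hU] at hf ⊢
    exact tendsto_setIntegral_of_monotone
      (fun j => (isOpen_openCylinder _ _).measurableSet) hmono hf
  have h1 := key (fun _ => 1) (integrableOn_const (volume_openCylinder_ne_top l h))
  simp only [setIntegral_const, smul_eq_mul, mul_one] at h1
  simp_rw [setAverage_eq, smul_eq_mul]
  refine (h1.inv₀ ?_).mul (key v hv)
  rw [measureReal_def, ENNReal.toReal_ne_zero]
  exact ⟨volume_openCylinder_ne_zero hl hh, volume_openCylinder_ne_top l h⟩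

/-- The main inequality, for functions of `H¹`. -/
theorem exists_mul_stripCap_le (hN : 3 < N)
    {K' : Set (EuclideanSpace ℝ (Fin (N - 1)))} (hK' : Bornology.IsBounded K') {δ : ℝ}
    (hδ : 0 < δ) :
    ∃ L τ : ℝ, 0 < L ∧ 0 < τ ∧ ∀ l h : ℝ, L ≤ l → 0 < h → h / l ^ (N - 1) ≤ τ →
      ∀ (v : SplitSpace N → ℝ) (g : SplitSpace N → SplitSpace N),
        IsH1With (openCylinder N l h) v g →
        EqWeaklyOn (openCylinder N l h) (flatSet K') v 1 →
        ENNReal.ofReal ((1 - ⨍ x in openCylinder N l h, v x) ^ 2) * stripCap h K' ≤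
          ENNReal.ofReal (1 + δ) * ∫⁻ x in openCylinder N l h, ‖g x‖ₑ ^ 2 := by
  obtain ⟨L, τ, hL, hτ, hsmooth⟩ := exists_mul_stripCap_le_of_contDiff hN hK' hδ
  obtain ⟨r, hr⟩ := hK'.subset_ball (0 : EuclideanSpace ℝ (Fin (N - 1)))
  -- Room for the shrunken cylinders: with `a ≥ 1 / 2`, the radius `a l` is still at least `L`, and
  -- the ratio grows at most by `2 ^ (N - 1)`. The term `r + 1` keeps the closure of `K' × {0}`
  -- inside the cylinder.
  refine ⟨max (2 * L) (r + 1), τ / 2 ^ (N - 1), lt_max_of_lt_left (by positivity), by positivity,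
    fun l h hl hh hhl v g hv hEq => ?_⟩
  have hl1 : 2 * L ≤ l := (le_max_left _ _).trans hl
  have hl2 : r + 1 ≤ l := (le_max_right _ _).trans hl
  have hl0 : 0 < l := by linarith
  have hCo := isOpen_openCylinder (N := N) l h
  have : IsFiniteMeasure (volume.restrict (openCylinder N l h)) :=
    ⟨by simpa using (volume_openCylinder_ne_top l h).lt_top⟩
  have hvi : IntegrableOn v (openCylinder N l h) := hv.memLp.integrable one_le_two
  have hcl : closure (flatSet K') ⊆ openCylinder N l h := fun x hx => by
    have h1 := closure_flatSet_subset hr hx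
    refine ⟨mem_ball_zero_iff.2 (by linarith [h1.1]), ?_⟩
    rw [h1.2]
    exact ⟨by linarith, hh⟩
  -- Mollification is controlled only away from the boundary, so the limit of smooth functions is
  -- taken on the cylinder shrunk by `a`. The capacity is brought back to height `h` at the price of
  -- `a⁻¹`.
  have step : ∀ a : ℝ, 1 / 2 ≤ a → a < 1 →
      ENNReal.ofReal ((1 - ⨍ x in openCylinder N (a * l) (a * h), v x) ^ 2) * stripCap h K' ≤
        ENNReal.ofReal a⁻¹ *
          (ENNReal.ofReal (1 + δ) * ∫⁻ x in openCylinder N l h, ‖g x‖ₑ ^ 2) := by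
    intro a ha ha1
    have ha0 : 0 < a := by linarith
    set S := openCylinder N (a * l) (a * h) with hS
    have hSm : MeasurableSet S := (isOpen_openCylinder _ _).measurableSet
    have hSC : S ⊆ openCylinder N l h := openCylinder_mono
      (mul_le_of_le_one_left hl0.le ha1.le) (mul_le_of_le_one_left hh.le ha1.le)
    have hρ : 0 < min ((1 - a) * l) ((1 - a) * h) :=
      lt_min (mul_pos (by linarith) hl0) (mul_pos (by linarith) hh)
    obtain ⟨V, hVc, hV1, hVv, hVg⟩ := hv.exists_contDiff_approx hCo
      (isCompact_closure_flatSet hK') hcl hSm hρ (fun x hx => closedBall_subset_openCylinder hx) hEq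
    have hal : L ≤ a * l := by nlinarith
    have hτa : a * h / (a * l) ^ (N - 1) ≤ τ := by
      rw [div_le_div_iff₀ (by positivity) (by positivity)] at hhl
      rw [div_le_iff₀ (by positivity)]
      have h1 : (l / 2) ^ (N - 1) ≤ (a * l) ^ (N - 1) := by
        gcongr
        linarith [mul_le_mul_of_nonneg_right ha hl0.le]
      have h2 : l ^ (N - 1) = 2 ^ (N - 1) * (l / 2) ^ (N - 1) := by
        rw [← mul_pow]
        congr 1
        ring
      have h3 : h ≤ τ * (l / 2) ^ (N - 1) := by
        rw [h2] at hhl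
        have : (0 : ℝ) < 2 ^ (N - 1) := by positivity
        nlinarith
      calc a * h ≤ h := mul_le_of_le_one_left hh.le ha1.le
        _ ≤ τ * (l / 2) ^ (N - 1) := h3
        _ ≤ _ := by gcongr
    set e : ℕ → ℝ≥0∞ := fun k =>
      eLpNorm (fun x => gradient (V k) x - g x) 2 (volume.restrict S) with he
    have he0 : Tendsto e atTop (𝓝 0) :=
      ENNReal.tendsto_zero_of_sq (by simpa only [he, eLpNorm_two_sq] using hVg)
    set G := eLpNorm g 2 (volume.restrict S) with hG
    have hgS : MemLp g 2 (volume.restrict S) :=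
      hv.memLp_grad.mono_measure (Measure.restrict_mono hSC le_rfl)
    -- Minkowski's inequality replaces the gradient of the approximation by `g` plus an error
    -- tending to zero in `L²`.
    have hk : ∀ k, ENNReal.ofReal ((1 - ⨍ x in S, V k x) ^ 2) * stripCap (a * h) K' ≤
        ENNReal.ofReal (1 + δ) * (G + e k) ^ 2 := fun k => by
      obtain ⟨O, hO, hKO, hO1⟩ := hV1 k
      refine (hsmooth (a * l) (a * h) hal (by positivity) hτa (V k) (hVc k) O hO hKO hO1).trans ?_
      gcongr 1
      simp_rw [← enorm_gradient]
      rw [← eLpNorm_two_sq]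
      refine pow_le_pow_left' ?_ 2
      have hgV := continuous_gradient (φ := V k) ((hVc k).of_le (by simp))
      have hadd := eLpNorm_add_le (p := 2) hgS.1
        (hgV.aestronglyMeasurable.sub hgS.1 :
          AEStronglyMeasurable (fun x => gradient (V k) x - g x) (volume.restrict S)) one_le_two
      refine le_trans (le_of_eq ?_) hadd
      congr 1
      ext1 x
      simp
    have hm := tendsto_setAverage_of_lintegral_sq
      (volume_openCylinder_ne_zero (N := N) (mul_pos ha0 hl0) (mul_pos ha0 hh))
      (volume_openCylinder_ne_top (a * l) (a * h))
      (fun k => integrableOn_openCylinder_of_continuous _ _ (hVc k).continuous)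
      (hvi.mono_set hSC) hVv
    have hb : Tendsto (fun k => ENNReal.ofReal (1 + δ) * (G + e k) ^ 2) atTop
        (𝓝 (ENNReal.ofReal (1 + δ) * (G + 0) ^ 2)) :=
      ENNReal.Tendsto.const_mul (ENNReal.Tendsto.pow (tendsto_const_nhds.add he0))
        (Or.inr ENNReal.ofReal_ne_top)
    have hfin := ENNReal.ofReal_mul_le_of_tendsto
      (((tendsto_const_nhds (x := (1 : ℝ))).sub hm).pow 2) hb hk
    rw [add_zero, hG, eLpNorm_two_sq] at hfin
    calc ENNReal.ofReal ((1 - ⨍ x in S, v x) ^ 2) * stripCap h K'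
        ≤ ENNReal.ofReal ((1 - ⨍ x in S, v x) ^ 2) *
            (ENNReal.ofReal a⁻¹ * stripCap (a * h) K') := by
          gcongr
          exact stripCap_le_mul_stripCap ha0 ha1.le K'
      _ = ENNReal.ofReal a⁻¹ *
            (ENNReal.ofReal ((1 - ⨍ x in S, v x) ^ 2) * stripCap (a * h) K') := by ring
      _ ≤ ENNReal.ofReal a⁻¹ * (ENNReal.ofReal (1 + δ) * ∫⁻ x in S, ‖g x‖ₑ ^ 2) := by
          gcongr
      _ ≤ _ := by gcongr
  set a : ℕ → ℝ := fun j => 1 - 1 / (j + 2) with ha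
  have hfrac : ∀ j : ℕ, (1 : ℝ) / (j + 2) ≤ 1 / 2 := fun j =>
    one_div_le_one_div_of_le two_pos (by linarith [(Nat.cast_nonneg j : (0 : ℝ) ≤ j)])
  have halim : Tendsto a atTop (𝓝 1) := by
    have : Tendsto (fun j : ℕ => (1 : ℝ) / (j + 2)) atTop (𝓝 0) :=
      tendsto_const_nhds.div_atTop
        (tendsto_atTop_add_const_right _ _ tendsto_natCast_atTop_atTop)
    simpa [ha] using (tendsto_const_nhds (x := (1 : ℝ))).sub this
  have ha2 : ∀ j, 1 / 2 ≤ a j := fun j => by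
    have := hfrac j
    simp only [ha]
    linarith
  have ha1 : ∀ j, a j < 1 := fun j => by
    have : (0 : ℝ) < 1 / (j + 2) := by positivity
    simp only [ha]
    linarith
  have hamono : Monotone a := fun i j hij => by
    have hij' : (i : ℝ) ≤ j := Nat.cast_le.2 hij
    simp only [ha]
    gcongr
  have hm := tendsto_setAverage_openCylinder hl0 hh hvi hamono (fun j => (ha1 j).le) halim
  have hE : ∫⁻ x in openCylinder N l h, ‖g x‖ₑ ^ 2 ≠ ⊤ := by
    rw [← eLpNorm_two_sq]
    exact ENNReal.pow_ne_top hv.memLp_grad.2.ne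
  have hb : Tendsto (fun j => ENNReal.ofReal (a j)⁻¹ *
      (ENNReal.ofReal (1 + δ) * ∫⁻ x in openCylinder N l h, ‖g x‖ₑ ^ 2)) atTop
      (𝓝 (ENNReal.ofReal 1⁻¹ *
        (ENNReal.ofReal (1 + δ) * ∫⁻ x in openCylinder N l h, ‖g x‖ₑ ^ 2))) :=
    ENNReal.Tendsto.mul_const (ENNReal.tendsto_ofReal (halim.inv₀ one_ne_zero))
      (Or.inr (ENNReal.mul_ne_top ENNReal.ofReal_ne_top hE))
  have hfin := ENNReal.ofReal_mul_le_of_tendsto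
    (((tendsto_const_nhds (x := (1 : ℝ))).sub hm).pow 2) hb fun j => step (a j) (ha2 j) (ha1 j)
  simpa using hfin

end Main

theorem mainTheorem8 (N : ℕ) (hN : 3 < N)
    (K' : Set (EuclideanSpace ℝ (Fin (N - 1)))) (hK' : Bornology.IsBounded K')
    (θ : ℝ) (hθ : θ ∈ Ioo (0 : ℝ) 1) :
    ∃ L τ c : ℝ, 0 < L ∧ 0 < τ ∧ 0 < c ∧
      ∀ l h : ℝ, L ≤ l → 0 < h → h / l ^ (N - 1) ≤ τ →
        ∀ (v : SplitSpace N → ℝ) (g : SplitSpace N → SplitSpace N),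
          IsH1With (openCylinder N l h) v g →
          EqWeaklyOn (openCylinder N l h) (flatSet K') v 1 →
          ∫⁻ x in openCylinder N l h, ‖g x‖ₑ ^ 2 < ENNReal.ofReal θ * stripCap h K' →
          c < ⨍ x in openCylinder N l h, v x := by
  obtain ⟨hθ0, hθ1⟩ := hθ
  have hδ : 0 < (1 - θ) / (2 * θ) := div_pos (by linarith) (by linarith)
  obtain ⟨L, τ, hL, hτ, hmain⟩ := exists_mul_stripCap_le hN hK' hδ
  -- With `c = (1 - θ) / 4`, a mean `m ≤ c` gives `(1 - m)² ≥ 1 - 2 c = (1 + θ) / 2`. The choice of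
  -- `δ` makes `(1 + δ) θ` equal to the same number, which contradicts the strict energy bound.
  refine ⟨L, τ, (1 - θ) / 4, hL, hτ, by linarith, fun l h hl hh hhl v g hv hEq hE => ?_⟩
  by_contra hc
  rw [not_lt] at hc
  set m := ⨍ x in openCylinder N l h, v x
  have h1 := hmain l h hl hh hhl v g hv hEq
  have h2 : ENNReal.ofReal (1 + (1 - θ) / (2 * θ)) * ∫⁻ x in openCylinder N l h, ‖g x‖ₑ ^ 2 <
      ENNReal.ofReal (1 + (1 - θ) / (2 * θ)) * (ENNReal.ofReal θ * stripCap h K') :=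
    (ENNReal.mul_lt_mul_iff_right (ENNReal.ofReal_pos.2 (by linarith)).ne'
      ENNReal.ofReal_ne_top).2 hE
  refine absurd (h1.trans_lt h2) (not_lt.2 ?_)
  rw [← mul_assoc, ← ENNReal.ofReal_mul (by linarith)]
  gcongr
  have h3 : (1 + (1 - θ) / (2 * θ)) * θ = (1 + θ) / 2 := by
    field_simp
    ring
  rw [h3]
  nlinarith
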